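/- Let $\kappa\in\mathbb R$ and let $T_0$ be the operator $T_0u=-u''$ on $\mathbb R\setminus\{0\}$, acting in $L^2(\mathbb R_-)\times L^2(\mathbb R_+)$ (complex valued functions, $\mathbb R_-=(-\infty,0)$, $\mathbb R_+=(0,+\infty)$), with domain the set of all $u=(u_-,u_+)\in H^2(\mathbb R_-)\times H^2(\mathbb R_+)$ that satisfy the transmission conditions $$u_+'(0)=u_-'(0),\qquad u_+'(0)=\kappa\,\big(u_+(0)-u_-(0)\big).$$ Then $T_0$ is self-adjoint, and the following hold. 1. For every $\kappa\in\mathbb R$, $\sigma_{ess}(T_0)=[0,+\infty)$. (The essential spectrum is the set of $z\in\mathbb C$ for which there is a sequence of unit vectors $u_n$ in the domain of $T_0$ with $u_n\to0$ weakly and $(T_0-z)u_n\to0$ in norm; the discrete spectrum is the set of isolated points of the spectrum that are eigenvalues of finite multiplicity.) 2. If $\kappa\ge0$, then the discrete spectrum of $T_0$ is empty and $\sigma(T_0)=[0,+\infty)$. 3. If $\kappa<0$, then $-4\kappa^2$ is the unique negative eigenvalue of $T_0$, it is simple, the discrete spectrum of $T_0$ is $\{-4\kappa^2\}$, and $\sigma(T_0)=\{-4\kappa^2\}\cup[0,+\infty)$.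 4. Let $\mu<0$ be a real number with $\mu\notin\sigma(T_0)$ and put $\ell_\mu(x)=e^{-\sqrt{-\mu}\,|x|}$. Then $$(T_0-\mu)^{-1}=(-\Delta-\mu)^{-1}+\frac{1}{2(\sqrt{-\mu}+2\kappa)}\begin{pmatrix}\langle\,\cdot\,,\ell_\mu\rangle_-\,(\ell_\mu)_- & -\langle\,\cdot\,,\ell_\mu\rangle_+\,(\ell_\mu)_-\\ -\langle\,\cdot\,,\ell_\mu\rangle_-\,(\ell_\mu)_+ & \langle\,\cdot\,,\ell_\mu\rangle_+\,(\ell_\mu)_+\end{pmatrix}.$$ Here $(\ell_\mu)_\pm$ is the restriction of $\ell_\mu$ to $\mathbb R_\pm$, $\langle g,h\rangle_\pm=\int_{\mathbb R_\pm}g\,\bar h$, and $(-\Delta-\mu)^{-1}$ is the resolvent at $\mu$ of the operator $-\Delta=-d^2/dx^2$ on $L^2(\mathbb R)$ with domain $H^2(\mathbb R)$ (which exists as a bounded operator), applied to $u_-\mathbf 1_{(-\infty,0)}+u_+\mathbf 1_{(0,+\infty)}$ and followed by $v\mapsto(v|_{\mathbb R_-},v|_{\mathbb R_+})$. Equivalently,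 for $\varepsilon,\sigma\in\{-,+\}$ the block of $(T_0-\mu)^{-1}$ from $L^2(\mathbb R_\sigma)$ to $L^2(\mathbb R_\varepsilon)$ is the integral operator with kernel $$\frac{1}{2\sqrt{-\mu}}e^{-\sqrt{-\mu}\,|x-y|}+\varepsilon\sigma\,\frac{1}{2(\sqrt{-\mu}+2\kappa)}e^{-\sqrt{-\mu}\,(|x|+|y|)}.$$ -/

import Mathlib

open MeasureTheory Set Filter Topology
open scoped ContDiff

noncomputable section

namespace SemiPermeable

/-! ### Spectral notions for an unbounded operator on a Hilbert space -/

section Spectral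

variable {H : Type*} [NormedAddCommGroup H] [InnerProductSpace ℂ H]

/-- The bounded operator `R` is the (everywhere defined) two-sided inverse of `T - z`. -/
def IsResolventAt (T : H →ₗ.[ℂ] H) (z : ℂ) (R : H →L[ℂ] H) : Prop :=
  (∀ f : H, ∃ h : R f ∈ T.domain, T ⟨R f, h⟩ - z • R f = f) ∧
  (∀ u : T.domain, R (T u - z • (u : H)) = u)

/-- The spectrum of `T`: the complex numbers `z` for which `T - z` has no bounded inverse. -/
def opSpectrum (T : H →ₗ.[ℂ] H) : Set ℂ :=
  {z | ¬ ∃ R : H →L[ℂ] H, IsResolventAt T z R}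

/-- The kernel of `T - z`. -/
def eigenspace (T : H →ₗ.[ℂ] H) (z : ℂ) : Submodule ℂ H where
  carrier := {u | ∃ h : u ∈ T.domain, T ⟨u, h⟩ = z • u}
  zero_mem' := ⟨T.domain.zero_mem, by
    have : (⟨0, T.domain.zero_mem⟩ : T.domain) = 0 := rfl
    rw [this, T.map_zero, smul_zero]⟩
  add_mem' := by
    rintro u v ⟨hu, eu⟩ ⟨hv, ev⟩
    refine ⟨T.domain.add_mem hu hv, ?_⟩
    have : (⟨u + v, T.domain.add_mem hu hv⟩ : T.domain) = ⟨u, hu⟩ + ⟨v, hv⟩ := rfl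
    rw [this, T.map_add, eu, ev, smul_add]
  smul_mem' := by
    rintro c u ⟨hu, eu⟩
    refine ⟨T.domain.smul_mem c hu, ?_⟩
    have : (⟨c • u, T.domain.smul_mem c hu⟩ : T.domain) = c • ⟨u, hu⟩ := rfl
    rw [this, T.map_smul, eu, smul_comm]

/-- `z` is an eigenvalue of `T`. -/
def IsEigenvalue (T : H →ₗ.[ℂ] H) (z : ℂ) : Prop :=
  ∃ u ∈ eigenspace T z, u ≠ 0

/-- `u` is a singular (Weyl) sequence for `T` at `z`: unit vectors of the domain, converging
weakly to `0`, with `(T - z) u n → 0` in norm. -/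
def IsSingularSequence (T : H →ₗ.[ℂ] H) (z : ℂ) (u : ℕ → T.domain) : Prop :=
  (∀ n, ‖(u n : H)‖ = 1) ∧
  (∀ v : H, Tendsto (fun n => inner ℂ v (u n : H)) atTop (𝓝 0)) ∧
  Tendsto (fun n => T (u n) - z • (u n : H)) atTop (𝓝 0)

/-- The essential spectrum of a self-adjoint operator, through singular sequences. -/
def essentialSpectrum (T : H →ₗ.[ℂ] H) : Set ℂ :=
  {z | ∃ u : ℕ → T.domain, IsSingularSequence T z u}

/-- The discrete spectrum of a self-adjoint operator: isolated points of the spectrum that are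
eigenvalues of finite multiplicity. -/
def discreteSpectrum (T : H →ₗ.[ℂ] H) : Set ℂ :=
  {z | z ∈ opSpectrum T ∧ (∃ ε > 0, ∀ w ∈ opSpectrum T, dist w z < ε → w = z) ∧
    IsEigenvalue T z ∧ FiniteDimensional ℂ (eigenspace T z)}

end Spectral

/-! ### Weak derivatives and traces -/

/-- On the open set `Ω ⊆ ℝ`, the function `w` is the derivative of `u` in the sense of
distributions (used for functions that are square integrable on `Ω`). -/
def HasWeakDeriv (Ω : Set ℝ) (u w : ℝ → ℂ) : Prop :=
  ∀ φ : ℝ → ℝ, ContDiff ℝ ∞ φ → HasCompactSupport φ → tsupport φ ⊆ Ω →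
    ∫ x in Ω, deriv φ x • u x = - ∫ x in Ω, φ x • w x

/-- The boundary value at `0` of `u` on the open half-line `Ω` is `c`: on `Ω`, `u` agrees almost
everywhere with a function which is continuous on the closed half-line and takes
the value `c` at `0`. -/
def HasTraceAtZero (Ω : Set ℝ) (u : ℝ → ℂ) (c : ℂ) : Prop :=
  ∃ g : ℝ → ℂ, ContinuousOn g (closure Ω) ∧ u =ᵐ[volume.restrict Ω] g ∧ g 0 = c

lemma HasWeakDeriv.congr {Ω : Set ℝ} {u w u' w' : ℝ → ℂ} (h : HasWeakDeriv Ω u w)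
    (hu : u' =ᵐ[volume.restrict Ω] u) (hw : w' =ᵐ[volume.restrict Ω] w) :
    HasWeakDeriv Ω u' w' := by
  intro φ h1 h2 h3
  have e1 : ∫ x in Ω, deriv φ x • u' x = ∫ x in Ω, deriv φ x • u x :=
    integral_congr_ae (by filter_upwards [hu] with x hx; rw [hx])
  have e2 : ∫ x in Ω, φ x • w' x = ∫ x in Ω, φ x • w x :=
    integral_congr_ae (by filter_upwards [hw] with x hx; rw [hx])
  rw [e1, e2]
  exact h φ h1 h2 h3

lemma HasTraceAtZero.congr {Ω : Set ℝ} {u u' : ℝ → ℂ} {c : ℂ} (h : HasTraceAtZero Ω u c)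
    (hu : u' =ᵐ[volume.restrict Ω] u) : HasTraceAtZero Ω u' c := by
  obtain ⟨g, h1, h2, h3⟩ := h
  exact ⟨g, h1, hu.trans h2, h3⟩

lemma integrable_test_smul {μ : Measure ℝ} [IsFiniteMeasureOnCompacts μ] {u : ℝ → ℂ}
    (hu : MemLp u 2 μ) {φ : ℝ → ℝ} (h1 : Continuous φ) (h2 : HasCompactSupport φ) :
    Integrable (fun x => φ x • u x) μ := by
  have hφ : MemLp (fun x => (φ x : ℂ)) 2 μ := by
    refine Continuous.memLp_of_hasCompactSupport (by fun_prop) ?_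
    exact h2.comp_left (g := fun t : ℝ => (t : ℂ)) (by simp)
  refine (hφ.integrable_mul hu).congr (Eventually.of_forall fun x => ?_)
  simp [Complex.real_smul]

lemma HasWeakDeriv.add {Ω : Set ℝ} {u w u' w' : ℝ → ℂ}
    (hu : MemLp u 2 (volume.restrict Ω)) (hw : MemLp w 2 (volume.restrict Ω))
    (hu' : MemLp u' 2 (volume.restrict Ω)) (hw' : MemLp w' 2 (volume.restrict Ω))
    (h : HasWeakDeriv Ω u w) (h' : HasWeakDeriv Ω u' w') :
    HasWeakDeriv Ω (u + u') (w + w') := by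
  intro φ h1 h2 h3
  have hd : Continuous (deriv φ) := h1.continuous_deriv (by simp)
  simp only [Pi.add_apply, smul_add]
  rw [integral_add (integrable_test_smul hu hd h2.deriv) (integrable_test_smul hu' hd h2.deriv),
    integral_add (integrable_test_smul hw h1.continuous h2)
      (integrable_test_smul hw' h1.continuous h2), h φ h1 h2 h3, h' φ h1 h2 h3]
  ring

lemma HasWeakDeriv.smul {Ω : Set ℝ} {u w : ℝ → ℂ} (c : ℂ) (h : HasWeakDeriv Ω u w) :
    HasWeakDeriv Ω (c • u) (c • w) := by
  intro φ h1 h2 h3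
  simp only [Pi.smul_apply]
  simp_rw [smul_comm _ c]
  rw [integral_smul, integral_smul, h φ h1 h2 h3, smul_neg]

lemma HasTraceAtZero.add {Ω : Set ℝ} {u u' : ℝ → ℂ} {c c' : ℂ}
    (h : HasTraceAtZero Ω u c) (h' : HasTraceAtZero Ω u' c') :
    HasTraceAtZero Ω (u + u') (c + c') := by
  obtain ⟨g, h1, h2, h3⟩ := h
  obtain ⟨g', h1', h2', h3'⟩ := h'
  exact ⟨g + g', h1.add h1', h2.add h2', by simp [h3, h3']⟩

lemma HasTraceAtZero.smul {Ω : Set ℝ} {u : ℝ → ℂ} {a : ℂ} (c : ℂ)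
    (h : HasTraceAtZero Ω u a) : HasTraceAtZero Ω (c • u) (c * a) := by
  obtain ⟨g, h1, h2, h3⟩ := h
  exact ⟨c • g, h1.const_smul c, h2.const_smul c, by simp [h3]⟩

/-- A square-integrable weak derivative is unique. -/
lemma HasWeakDeriv.ae_eq_zero {Ω : Set ℝ} (hΩ : IsOpen Ω) {u w : ℝ → ℂ}
    (hw : MemLp w 2 (volume.restrict Ω)) (hu : u =ᵐ[volume.restrict Ω] 0)
    (h : HasWeakDeriv Ω u w) : w =ᵐ[volume.restrict Ω] 0 := by
  have hloc : LocallyIntegrableOn w Ω (volume.restrict Ω) :=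
    (hw.locallyIntegrable (by norm_num)).locallyIntegrableOn Ω
  have key := hΩ.ae_eq_zero_of_integral_contDiff_smul_eq_zero hloc (fun φ h1 h2 h3 => by
    have e := h φ h1 h2 h3
    have e1 : ∫ x in Ω, deriv φ x • u x = 0 := by
      rw [integral_congr_ae (g := fun _ => (0 : ℂ))
        (by filter_upwards [hu] with x hx; simp [hx])]
      simp
    rw [e1] at e
    exact neg_eq_zero.mp e.symm)
  filter_upwards [key, ae_restrict_mem hΩ.measurableSet] with x hx hm
  exact hx hm

/-! ### The Hilbert spaces -/

/-- `L²(Ω)` with respect to Lebesgue measure, complex valued. -/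
abbrev L2 (Ω : Set ℝ) : Type := Lp ℂ 2 (volume.restrict Ω)

/-- The Hilbert space `L²(ℝ₋) × L²(ℝ₊)`. -/
abbrev TwoSided : Type := WithLp 2 (L2 (Iio 0) × L2 (Ioi 0))

/-- `L²(ℝ)`. -/
abbrev L2Line : Type := Lp ℂ 2 (volume : Measure ℝ)

lemma HasWeakDeriv.add_Lp {Ω : Set ℝ} {u w u' w' : L2 Ω} (h : HasWeakDeriv Ω u w)
    (h' : HasWeakDeriv Ω u' w') : HasWeakDeriv Ω (u + u' : L2 Ω) (w + w' : L2 Ω) :=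
  (HasWeakDeriv.add (Lp.memLp u) (Lp.memLp w) (Lp.memLp u') (Lp.memLp w') h h').congr
    (Lp.coeFn_add u u') (Lp.coeFn_add w w')

lemma HasWeakDeriv.smul_Lp {Ω : Set ℝ} {u w : L2 Ω} (c : ℂ) (h : HasWeakDeriv Ω u w) :
    HasWeakDeriv Ω (c • u : L2 Ω) (c • w : L2 Ω) :=
  (HasWeakDeriv.smul c h).congr (Lp.coeFn_smul c u) (Lp.coeFn_smul c w)

lemma HasTraceAtZero.add_Lp {Ω : Set ℝ} {u u' : L2 Ω} {c c' : ℂ} (h : HasTraceAtZero Ω u c)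
    (h' : HasTraceAtZero Ω u' c') : HasTraceAtZero Ω (u + u' : L2 Ω) (c + c') :=
  (HasTraceAtZero.add h h').congr (Lp.coeFn_add u u')

lemma HasTraceAtZero.smul_Lp {Ω : Set ℝ} {u : L2 Ω} {a : ℂ} (c : ℂ)
    (h : HasTraceAtZero Ω u a) : HasTraceAtZero Ω (c • u : L2 Ω) (c * a) :=
  (HasTraceAtZero.smul c h).congr (Lp.coeFn_smul c u)

lemma HasWeakDeriv.zero_Lp {Ω : Set ℝ} : HasWeakDeriv Ω (0 : L2 Ω) (0 : L2 Ω) := by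
  have h : HasWeakDeriv Ω 0 0 := by intro φ _ _ _; simp
  exact h.congr (Lp.coeFn_zero _ _ _) (Lp.coeFn_zero _ _ _)

lemma HasTraceAtZero.zero_Lp {Ω : Set ℝ} : HasTraceAtZero Ω (0 : L2 Ω) 0 :=
  ⟨0, continuousOn_const, Lp.coeFn_zero _ _ _, rfl⟩

lemma HasWeakDeriv.eq_zero_Lp {Ω : Set ℝ} (hΩ : IsOpen Ω) {w : L2 Ω}
    (h : HasWeakDeriv Ω (0 : L2 Ω) w) : w = 0 :=
  Lp.ext ((h.ae_eq_zero hΩ (Lp.memLp w) (Lp.coeFn_zero _ _ _)).trans (Lp.coeFn_zero _ _ _).symm)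

/-! ### The Laplacian with a semi-permeable barrier at `0` -/

/-- The pairs `(u, f)` with `u ∈ H²(ℝ₋) × H²(ℝ₊)`, `f = -u''`, such that `u` satisfies the
transmission conditions `u'(0₊) = u'(0₋)` and `u'(0₊) = κ (u(0₊) - u(0₋))`. -/
def barrierGraph (κ : ℝ) : Submodule ℂ (TwoSided × TwoSided) where
  carrier := {p | ∃ (v : TwoSided) (um up vm vp : ℂ),
    -- `v = u'` and `-f = u''` on each side
    (HasWeakDeriv (Iio 0) p.1.fst v.fst ∧ HasWeakDeriv (Iio 0) v.fst (-p.2).fst) ∧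
    (HasWeakDeriv (Ioi 0) p.1.snd v.snd ∧ HasWeakDeriv (Ioi 0) v.snd (-p.2).snd) ∧
    -- `um, up, vm, vp` are the boundary values of `u` and `u'` at `0₋` and `0₊`
    (HasTraceAtZero (Iio 0) p.1.fst um ∧ HasTraceAtZero (Ioi 0) p.1.snd up) ∧
    (HasTraceAtZero (Iio 0) v.fst vm ∧ HasTraceAtZero (Ioi 0) v.snd vp) ∧
    vp = vm ∧ vp = κ * (up - um)}
  zero_mem' := by
    refine ⟨0, 0, 0, 0, 0, ⟨.zero_Lp, ?_⟩, ⟨.zero_Lp, ?_⟩, ⟨.zero_Lp, .zero_Lp⟩,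
      ⟨.zero_Lp, .zero_Lp⟩, rfl, by simp⟩
    · simpa using HasWeakDeriv.zero_Lp
    · simpa using HasWeakDeriv.zero_Lp
  add_mem' := by
    rintro p q ⟨v, a, b, c, d, ⟨h1, h2⟩, ⟨h3, h4⟩, ⟨h5, h6⟩, ⟨h7, h8⟩, h9, h10⟩
      ⟨v', a', b', c', d', ⟨k1, k2⟩, ⟨k3, k4⟩, ⟨k5, k6⟩, ⟨k7, k8⟩, k9, k10⟩
    refine ⟨v + v', a + a', b + b', c + c', d + d', ⟨h1.add_Lp k1, ?_⟩, ⟨h3.add_Lp k3, ?_⟩,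
      ⟨h5.add_Lp k5, h6.add_Lp k6⟩, ⟨h7.add_Lp k7, h8.add_Lp k8⟩, by rw [h9, k9], ?_⟩
    · rw [Prod.snd_add, neg_add]; exact h2.add_Lp k2
    · rw [Prod.snd_add, neg_add]; exact h4.add_Lp k4
    · rw [h10, k10]; ring
  smul_mem' := by
    rintro t p ⟨v, a, b, c, d, ⟨h1, h2⟩, ⟨h3, h4⟩, ⟨h5, h6⟩, ⟨h7, h8⟩, h9, h10⟩
    refine ⟨t • v, t * a, t * b, t * c, t * d, ⟨h1.smul_Lp t, ?_⟩, ⟨h3.smul_Lp t, ?_⟩,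
      ⟨h5.smul_Lp t, h6.smul_Lp t⟩, ⟨h7.smul_Lp t, h8.smul_Lp t⟩, by rw [h9], ?_⟩
    · rw [Prod.smul_snd, ← smul_neg]; exact h2.smul_Lp t
    · rw [Prod.smul_snd, ← smul_neg]; exact h4.smul_Lp t
    · rw [h10]; ring

/-- The operator `T₀ = -d²/dx²` on `ℝ ∖ {0}` with domain
`{u ∈ H²(ℝ₋) × H²(ℝ₊) : u'(0₊) = u'(0₋) = κ (u(0₊) - u(0₋))}`. -/
def barrierLaplacian (κ : ℝ) : TwoSided →ₗ.[ℂ] TwoSided := (barrierGraph κ).toLinearPMap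

lemma barrierGraph_functional (κ : ℝ) (p : TwoSided × TwoSided) (hp : p ∈ barrierGraph κ)
    (h0 : p.1 = 0) : p.2 = 0 := by
  obtain ⟨v, a, b, c, d, ⟨h1, h2⟩, ⟨h3, h4⟩, -⟩ := hp
  rw [h0] at h1 h3
  have e1 : v.fst = 0 := h1.eq_zero_Lp isOpen_Iio
  have e3 : v.snd = 0 := h3.eq_zero_Lp isOpen_Ioi
  rw [e1] at h2
  rw [e3] at h4
  have e2 : (-p.2).fst = 0 := h2.eq_zero_Lp isOpen_Iio
  have e4 : (-p.2).snd = 0 := h4.eq_zero_Lp isOpen_Ioi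
  rw [WithLp.neg_fst, neg_eq_zero] at e2
  rw [WithLp.neg_snd, neg_eq_zero] at e4
  exact (WithLp.ofLp_injective 2) (Prod.ext e2 e4)

/-- The graph of `T₀` is the set of pairs described in `barrierGraph`. -/
lemma barrierLaplacian_graph (κ : ℝ) : (barrierLaplacian κ).graph = barrierGraph κ :=
  Submodule.toLinearPMap_graph_eq _ fun p hp h0 => barrierGraph_functional κ p hp h0

/-! ### The Laplacian on the line -/

/-- The pairs `(u, f)` with `u ∈ H²(ℝ)` and `f = -u''`. -/
def lineGraph : Submodule ℂ (L2Line × L2Line) where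
  carrier := {p | ∃ v : L2Line, HasWeakDeriv univ p.1 v ∧ HasWeakDeriv univ v (-p.2 : L2Line)}
  zero_mem' := by
    have h : HasWeakDeriv univ (0 : L2Line) (0 : L2Line) := by
      have h : HasWeakDeriv univ 0 0 := by intro φ _ _ _; simp
      refine h.congr ?_ ?_ <;> rw [Measure.restrict_univ] <;> exact Lp.coeFn_zero _ _ _
    exact ⟨0, h, by simpa using h⟩
  add_mem' := by
    have key : ∀ u w u' w' : L2Line, HasWeakDeriv univ u w → HasWeakDeriv univ u' w' →
        HasWeakDeriv univ (u + u' : L2Line) (w + w' : L2Line) := by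
      intro u w u' w' h h'
      have m : ∀ x : L2Line, MemLp x 2 (volume.restrict univ) := fun x => by
        rw [Measure.restrict_univ]; exact Lp.memLp x
      refine (HasWeakDeriv.add (m u) (m w) (m u') (m w') h h').congr ?_ ?_ <;>
        rw [Measure.restrict_univ] <;> exact Lp.coeFn_add _ _
    rintro p q ⟨v, h1, h2⟩ ⟨v', k1, k2⟩
    refine ⟨v + v', key _ _ _ _ h1 k1, ?_⟩
    rw [Prod.snd_add, neg_add]
    exact key _ _ _ _ h2 k2
  smul_mem' := by
    have key : ∀ (c : ℂ) (u w : L2Line), HasWeakDeriv univ u w →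
        HasWeakDeriv univ (c • u : L2Line) (c • w : L2Line) := by
      intro c u w h
      refine (HasWeakDeriv.smul c h).congr ?_ ?_ <;>
        rw [Measure.restrict_univ] <;> exact Lp.coeFn_smul _ _
    rintro c p ⟨v, h1, h2⟩
    refine ⟨c • v, key _ _ _ h1, ?_⟩
    rw [Prod.smul_snd, ← smul_neg]
    exact key _ _ _ h2

/-- The operator `-Δ = -d²/dx²` on `L²(ℝ)` with domain `H²(ℝ)`. -/
def lineLaplacian : L2Line →ₗ.[ℂ] L2Line := lineGraph.toLinearPMap

/-- The graph of `-Δ` is the set of pairs described in `lineGraph`. -/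
lemma lineLaplacian_graph : lineLaplacian.graph = lineGraph := by
  refine Submodule.toLinearPMap_graph_eq _ fun p hp h0 => ?_
  have key : ∀ w : L2Line, HasWeakDeriv univ (0 : L2Line) w → w = 0 := by
    intro w h
    have e := h.ae_eq_zero isOpen_univ (by rw [Measure.restrict_univ]; exact Lp.memLp w)
      (by rw [Measure.restrict_univ]; exact Lp.coeFn_zero _ _ _)
    rw [Measure.restrict_univ] at e
    exact Lp.ext (e.trans (Lp.coeFn_zero _ _ _).symm)
  obtain ⟨v, h1, h2⟩ := hp
  rw [h0] at h1
  rw [key v h1] at h2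
  exact neg_eq_zero.mp (key _ h2)

/-! ### Ingredients of the resolvent formula -/

/-- Extension by zero and addition: `(u₋, u₊) ↦ u₋ 1_{(-∞,0)} + u₊ 1_{(0,∞)}`. -/
def glue (u : TwoSided) : L2Line :=
  MemLp.toLp (fun x => (Iio (0 : ℝ)).indicator u.fst x + (Ioi (0 : ℝ)).indicator u.snd x)
    (((memLp_indicator_iff_restrict measurableSet_Iio).mpr (Lp.memLp u.fst)).add
      ((memLp_indicator_iff_restrict measurableSet_Ioi).mpr (Lp.memLp u.snd)))

/-- The restriction of `v ∈ L²(ℝ)` to `Ω`. -/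
def restrictTo (Ω : Set ℝ) (v : L2Line) : L2 Ω :=
  MemLp.toLp v ((Lp.memLp v).restrict Ω)

/-- The map `v ↦ (v|_{ℝ₋}, v|_{ℝ₊})`. -/
def split (v : L2Line) : TwoSided :=
  WithLp.toLp 2 (restrictTo (Iio 0) v, restrictTo (Ioi 0) v)

lemma memLp_exp_abs {s : ℝ} (hs : 0 < s) :
    MemLp (fun x : ℝ => (Real.exp (-s * |x|) : ℂ)) 2 volume := by
  have hm : AEStronglyMeasurable (fun x : ℝ => (Real.exp (-s * |x|) : ℂ)) volume :=
    (by fun_prop : Continuous fun x : ℝ => (Real.exp (-s * |x|) : ℂ)).aestronglyMeasurable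
  rw [memLp_two_iff_integrable_sq_norm hm]
  have e : ∀ x : ℝ, ‖(Real.exp (-s * |x|) : ℂ)‖ ^ 2 = Real.exp (-(2 * s) * |x|) := by
    intro x
    rw [Complex.norm_real, Real.norm_eq_abs, abs_of_pos (Real.exp_pos _), ← Real.exp_nat_mul]
    congr 1
    push_cast
    ring
  simp_rw [e]
  rw [← integrableOn_univ, ← Iic_union_Ioi (a := (0 : ℝ))]
  refine IntegrableOn.union ?_ ?_
  · refine (integrableOn_exp_mul_Iic (a := 2 * s) (by positivity) 0).congr_fun ?_
      measurableSet_Iic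
    intro x hx
    simp only [abs_of_nonpos (mem_Iic.mp hx)]
    congr 1
    ring
  · refine (integrableOn_exp_mul_Ioi (a := -(2 * s)) (by linarith) 0).congr_fun ?_
      measurableSet_Ioi
    intro x hx
    simp only [abs_of_pos (mem_Ioi.mp hx)]

/-- The function `x ↦ e^{-s|x|}` as an element of `L²(Ω)`, for `s > 0`. -/
def expAbs (Ω : Set ℝ) {s : ℝ} (hs : 0 < s) : L2 Ω :=
  MemLp.toLp (fun x : ℝ => (Real.exp (-s * |x|) : ℂ)) ((memLp_exp_abs hs).restrict Ω)

/-- The operator matrix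
`(⟨·, ℓ₋⟩ ℓ₋, -⟨·, ℓ₊⟩ ℓ₋ ; -⟨·, ℓ₋⟩ ℓ₊, ⟨·, ℓ₊⟩ ℓ₊)` with `ℓ(x) = e^{-s|x|}`, applied to `f`.
Here `⟨g, h⟩ = ∫ g h̄`, which is `inner ℂ h g`. -/
def barrierPerturbation {s : ℝ} (hs : 0 < s) (f : TwoSided) : TwoSided :=
  WithLp.toLp 2
    (inner ℂ (expAbs (Iio 0) hs) f.fst • expAbs (Iio 0) hs
        - inner ℂ (expAbs (Ioi 0) hs) f.snd • expAbs (Iio 0) hs,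
      - (inner ℂ (expAbs (Iio 0) hs) f.fst • expAbs (Ioi 0) hs)
        + inner ℂ (expAbs (Ioi 0) hs) f.snd • expAbs (Ioi 0) hs)

/-- The kernel `e^{-s|x-y|} / (2s) + τ e^{-s(|x|+|y|)} / (2(s+2κ))`, where `τ = 1` when `x` and
`y` lie on the same side of the barrier and `τ = -1` otherwise. -/
def barrierKernel (κ s τ x y : ℝ) : ℝ :=
  1 / (2 * s) * Real.exp (-s * |x - y|)
    + τ * (1 / (2 * (s + 2 * κ))) * Real.exp (-s * (|x| + |y|))

/-- The half-line `[0, ∞)` as a subset of `ℂ`. -/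
def nonnegHalfLine : Set ℂ := (fun r : ℝ => (r : ℂ)) '' Ici 0

end SemiPermeable

end

noncomputable section

namespace SemiPermeable

/-! Everything rests on an explicit inverse of `T₀ + s²` for `s > 0`. On the whole line, `-u'' + s²
u = f` is solved by convolution with `e^{-s|x|} / (2s)`. This kernel is the sum of two one-sided
exponentials, each of which inverts a first-order operator. The solution `u` is continuously
differentiable across `0`, so it has no jump and in general violates the second transmission
condition. Adding `a` times the odd function `(-ℓ₋, ℓ₊)`, `ℓ = e^{-s|x|}`, repairs this: that
function solves the homogeneous equation, jumps by `2` at the barrier, and has the same derivative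
`-s` on both sides. The condition becomes `u'(0) - a s = 2 κ a`, and since `2 u'(0)` is the inner
product of `f` with the odd function, the correction is the rank-one operator with coefficient `1 /
(2 (s + 2 κ))` (`isResolventAt_barrierResolvent`).

Square integrable solutions of the homogeneous problem are multiples `b` of the odd function with `b
(s + 2 κ) = 0` (`exists_smul_oddExp_of_mem_barrierGraph`). Hence the only possible negative spectral
point is the one with `s = -2 κ`. It occurs exactly when `κ < 0`, and it is then a simple
eigenvalue.

The rest is abstract. A symmetric bounded resolvent at one real point makes `T₀` self-adjoint
(`isSelfAdjoint_of_resolvent`) and yields the resolvent at every nonreal point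
(`exists_isResolventAt_of_im_ne_zero`). Wave packets that spread out and escape to `+∞`, never
touching the barrier, put all of `[0, ∞)` in the essential spectrum (`sq_mem_essentialSpectrum`).
The eigenvalue `-4 κ²` is not essential, because the resolvents for `κ` and for `0` differ by a
rank-one operator and `-4 κ²` is in the resolvent set for `0`
(`notMem_essentialSpectrum_of_rank_one`). -/

/-! ### Convolution operators on `L²(ℝ)` -/

/-- Convolution of `f` with the kernel `k`. -/
def convFun (k f : ℝ → ℂ) (x : ℝ) : ℂ := ∫ y, k (x - y) * f y

lemma MemLp.comp_sub_left' {k : ℝ → ℂ} (hk : MemLp k 2 volume) (x : ℝ) :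
    MemLp (fun y => k (x - y)) 2 volume :=
  hk.comp_measurePreserving (Measure.measurePreserving_sub_left volume x)

/-- Square integrability of the kernel makes the convolution integral converge at every point, not
only almost everywhere, so that additivity of `convFun` is an identity of functions. -/
lemma integrable_kernel_mul {k f : ℝ → ℂ} (hk : MemLp k 2 volume) (hf : MemLp f 2 volume)
    (x : ℝ) : Integrable (fun y => k (x - y) * f y) volume :=
  (MemLp.comp_sub_left' hk x).integrable_mul hf

lemma aestronglyMeasurable_kernel_prod {k f : ℝ → ℂ} (hk : Measurable k)
    (hf : AEStronglyMeasurable f volume) :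
    AEStronglyMeasurable (fun p : ℝ × ℝ => k (p.1 - p.2) * f p.2) (volume.prod volume) :=
  (hk.comp (measurable_fst.sub measurable_snd)).aestronglyMeasurable.mul hf.comp_snd

lemma aestronglyMeasurable_convFun {k f : ℝ → ℂ} (hk : Measurable k)
    (hf : AEStronglyMeasurable f volume) : AEStronglyMeasurable (convFun k f) volume :=
  (aestronglyMeasurable_kernel_prod hk hf).integral_prod_right'

/-- Cauchy–Schwarz after writing `|k| |f| = |k|^{1/2} · |k|^{1/2} |f|`; this is the pointwise half
of Young's inequality for `L¹ * L²`. -/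
lemma enorm_convFun_sq_le {k f : ℝ → ℂ} (hk : Measurable k)
    (hf : AEStronglyMeasurable f volume) (x : ℝ) :
    ‖convFun k f x‖ₑ ^ (2 : ℝ) ≤
      (∫⁻ y, ‖k y‖ₑ) * ∫⁻ y, ‖k (x - y)‖ₑ * ‖f y‖ₑ ^ (2 : ℝ) := by
  have hkx : Measurable fun y => ‖k (x - y)‖ₑ := (hk.comp (measurable_const.sub measurable_id)).enorm
  have h1 : ‖convFun k f x‖ₑ ≤ ∫⁻ y, ‖k (x - y)‖ₑ ^ (1 / 2 : ℝ) *
      (‖k (x - y)‖ₑ ^ (1 / 2 : ℝ) * ‖f y‖ₑ) := by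
    refine (enorm_integral_le_lintegral_enorm _).trans (le_of_eq ?_)
    refine lintegral_congr fun y => ?_
    rw [enorm_mul, ← mul_assoc, ← ENNReal.rpow_add_of_nonneg _ _ (by norm_num) (by norm_num)]
    norm_num
  have h2 := ENNReal.lintegral_mul_le_Lp_mul_Lq volume
    (Real.HolderConjugate.two_two) (f := fun y => ‖k (x - y)‖ₑ ^ (1 / 2 : ℝ))
    (g := fun y => ‖k (x - y)‖ₑ ^ (1 / 2 : ℝ) * ‖f y‖ₑ)
    (hkx.pow_const _).aemeasurable ((hkx.pow_const _).aemeasurable.mul hf.enorm)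
  have h3 := ENNReal.rpow_le_rpow (h1.trans h2) (z := 2) (by norm_num)
  refine h3.trans (le_of_eq ?_)
  rw [ENNReal.mul_rpow_of_nonneg _ _ (by norm_num), ← ENNReal.rpow_mul, ← ENNReal.rpow_mul]
  norm_num
  congr 1
  · calc ∫⁻ y, (‖k (x - y)‖ₑ ^ (1 / 2 : ℝ)) ^ 2 = ∫⁻ y, ‖k (x - y)‖ₑ := by
          refine lintegral_congr fun y => ?_
          rw [← ENNReal.rpow_natCast, ← ENNReal.rpow_mul]; norm_num
      _ = _ := lintegral_sub_left_eq_self (fun y => ‖k y‖ₑ) x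
  · refine lintegral_congr fun y => ?_
    rw [mul_pow]
    congr 1
    rw [← ENNReal.rpow_natCast, ← ENNReal.rpow_mul]; norm_num

/-- Integrate the pointwise bound in `x` and exchange the integrals: translation invariance turns
the inner integral into a second factor `‖k‖₁`. -/
lemma lintegral_convFun_sq_le {k f : ℝ → ℂ} (hk : Measurable k)
    (hf : AEStronglyMeasurable f volume) :
    ∫⁻ x, ‖convFun k f x‖ₑ ^ (2 : ℝ) ≤
      (∫⁻ y, ‖k y‖ₑ) ^ (2 : ℝ) * ∫⁻ y, ‖f y‖ₑ ^ (2 : ℝ) := by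
  have hm : AEMeasurable (fun p : ℝ × ℝ => ‖k (p.1 - p.2)‖ₑ * ‖f p.2‖ₑ ^ (2 : ℝ))
      (volume.prod volume) :=
    (hk.comp (measurable_fst.sub measurable_snd)).enorm.aemeasurable.mul
      (hf.comp_snd.enorm.pow_const _)
  calc ∫⁻ x, ‖convFun k f x‖ₑ ^ (2 : ℝ)
      ≤ ∫⁻ x, (∫⁻ y, ‖k y‖ₑ) * ∫⁻ y, ‖k (x - y)‖ₑ * ‖f y‖ₑ ^ (2 : ℝ) :=
        lintegral_mono fun x => enorm_convFun_sq_le hk hf x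
    _ = (∫⁻ y, ‖k y‖ₑ) * ∫⁻ x, ∫⁻ y, ‖k (x - y)‖ₑ * ‖f y‖ₑ ^ (2 : ℝ) :=
        lintegral_const_mul'' _ hm.lintegral_prod_right'
    _ = (∫⁻ y, ‖k y‖ₑ) * ∫⁻ y, ∫⁻ x, ‖k (x - y)‖ₑ * ‖f y‖ₑ ^ (2 : ℝ) := by
        rw [lintegral_lintegral_swap hm]
    _ = (∫⁻ y, ‖k y‖ₑ) * ∫⁻ y, (∫⁻ x, ‖k x‖ₑ) * ‖f y‖ₑ ^ (2 : ℝ) := by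
        congr 1
        refine lintegral_congr fun y => ?_
        rw [lintegral_mul_const _
          (show Measurable fun x => k (x - y) from hk.comp (measurable_id.sub measurable_const)).enorm]
        congr 1
        exact lintegral_sub_right_eq_self (fun x => ‖k x‖ₑ) y
    _ = _ := by
        rw [lintegral_const_mul'' _ (hf.enorm.pow_const _), ← mul_assoc]
        congr 1
        norm_num [sq]

lemma eLpNorm_convFun_le {k f : ℝ → ℂ} (hk : Measurable k)
    (hf : AEStronglyMeasurable f volume) :
    eLpNorm (convFun k f) 2 volume ≤ (∫⁻ y, ‖k y‖ₑ) * eLpNorm f 2 volume := by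
  simp only [eLpNorm_eq_lintegral_rpow_enorm_toReal (p := 2) (by norm_num) (by norm_num)]
  have h := ENNReal.rpow_le_rpow (lintegral_convFun_sq_le hk hf) (z := 1 / 2) (by norm_num)
  rw [ENNReal.mul_rpow_of_nonneg _ _ (by norm_num), ← ENNReal.rpow_mul] at h
  simpa using h

/-- A measurable kernel that is both integrable and square integrable. -/
structure IsConvKernel (k : ℝ → ℂ) : Prop where
  measurable : Measurable k
  integrable : Integrable k volume
  memLp : MemLp k 2 volume

lemma IsConvKernel.memLp_convFun {k f : ℝ → ℂ} (hk : IsConvKernel k) (hf : MemLp f 2 volume) :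
    MemLp (convFun k f) 2 volume :=
  ⟨aestronglyMeasurable_convFun hk.measurable hf.1,
    (eLpNorm_convFun_le hk.measurable hf.1).trans_lt
      (ENNReal.mul_lt_top hk.integrable.2 hf.2)⟩

lemma convFun_congr {k f g : ℝ → ℂ} (h : f =ᵐ[volume] g) : convFun k f = convFun k g := by
  funext x
  exact integral_congr_ae (by filter_upwards [h] with y hy; rw [hy])

lemma IsConvKernel.convFun_add {k f g : ℝ → ℂ} (hk : IsConvKernel k) (hf : MemLp f 2 volume)
    (hg : MemLp g 2 volume) : convFun k (f + g) = convFun k f + convFun k g := by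
  funext x
  simp only [convFun, Pi.add_apply, mul_add]
  exact integral_add (integrable_kernel_mul hk.memLp hf x) (integrable_kernel_mul hk.memLp hg x)

lemma convFun_smul (k f : ℝ → ℂ) (c : ℂ) : convFun k (c • f) = c • convFun k f := by
  funext x
  simp only [convFun, Pi.smul_apply, smul_eq_mul, ← integral_const_mul]
  congr 1
  funext y
  ring

/-- The bounded operator of convolution with `k` on `L²(ℝ)`. -/
def convCLM (k : ℝ → ℂ) (hk : IsConvKernel k) : L2Line →L[ℂ] L2Line :=
  LinearMap.mkContinuous
    { toFun := fun f => (hk.memLp_convFun (Lp.memLp f)).toLp (convFun k f)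
      map_add' := fun f g => by
        rw [← MemLp.toLp_add]
        refine MemLp.toLp_congr _ _ (Eventually.of_forall fun x => ?_)
        rw [convFun_congr (Lp.coeFn_add f g), hk.convFun_add (Lp.memLp f) (Lp.memLp g)]
      map_smul' := fun c f => by
        rw [RingHom.id_apply, ← MemLp.toLp_const_smul]
        refine MemLp.toLp_congr _ _ (Eventually.of_forall fun x => ?_)
        rw [convFun_congr (Lp.coeFn_smul c f), convFun_smul] }
    (∫⁻ y, ‖k y‖ₑ).toReal
    (fun f => by
      simp only [LinearMap.coe_mk, AddHom.coe_mk, Lp.norm_toLp]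
      rw [Lp.norm_def, ← ENNReal.toReal_mul]
      exact ENNReal.toReal_mono (ENNReal.mul_lt_top hk.integrable.2 (Lp.eLpNorm_lt_top f)).ne
        (eLpNorm_convFun_le hk.measurable (Lp.aestronglyMeasurable f)))

lemma convCLM_coeFn (k : ℝ → ℂ) (hk : IsConvKernel k) (f : L2Line) :
    convCLM k hk f =ᵐ[volume] convFun k f :=
  MemLp.coeFn_toLp (hk.memLp_convFun (Lp.memLp f))

/-- The product is dominated by `(|f(y)|² + |g(x)|²) |k(x - y)|`, and each summand is a convolution
integrand of two integrable functions. This is the hypothesis of Fubini's theorem for the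
transposition formula. -/
lemma integrable_kernel_triple {k f g : ℝ → ℂ} (hk : IsConvKernel k) (hf : MemLp f 2 volume)
    (hg : MemLp g 2 volume) :
    Integrable (fun p : ℝ × ℝ => g p.1 * (k (p.1 - p.2) * f p.2)) (volume.prod volume) := by
  have hf2 : Integrable (fun y => ‖f y‖ ^ 2) volume :=
    (memLp_two_iff_integrable_sq_norm hf.1).mp hf
  have hg2 : Integrable (fun y => ‖g y‖ ^ 2) volume :=
    (memLp_two_iff_integrable_sq_norm hg.1).mp hg
  have h1 : Integrable (fun p : ℝ × ℝ => ‖f p.2‖ ^ 2 * ‖k (p.1 - p.2)‖) (volume.prod volume) :=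
    hf2.convolution_integrand (ContinuousLinearMap.mul ℝ ℝ) hk.integrable.norm
  have h2 : Integrable (fun p : ℝ × ℝ => ‖g p.1‖ ^ 2 * ‖k (p.1 - p.2)‖) (volume.prod volume) := by
    have := (hg2.convolution_integrand (ContinuousLinearMap.mul ℝ ℝ)
      hk.integrable.norm.comp_neg).swap
    refine this.congr (Eventually.of_forall fun p => ?_)
    simp
  refine (h1.add h2).mono' (hg.1.comp_fst.mul
    (aestronglyMeasurable_kernel_prod hk.measurable hf.1)) (Eventually.of_forall fun p => ?_)
  simp only [norm_mul, Pi.add_apply]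
  have hk0 := norm_nonneg (k (p.1 - p.2))
  have : ‖g p.1‖ * ‖f p.2‖ ≤ ‖f p.2‖ ^ 2 + ‖g p.1‖ ^ 2 := by
    nlinarith [sq_nonneg (‖g p.1‖ - ‖f p.2‖), sq_nonneg (‖g p.1‖), sq_nonneg (‖f p.2‖)]
  nlinarith [mul_le_mul_of_nonneg_right this hk0]

/-- The transpose of convolution with `k` is convolution with `x ↦ k (-x)`. -/
lemma integral_mul_convFun {k f g : ℝ → ℂ} (hk : IsConvKernel k) (hf : MemLp f 2 volume)
    (hg : MemLp g 2 volume) :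
    ∫ x, g x * convFun k f x = ∫ y, convFun (fun t => k (-t)) g y * f y := by
  calc ∫ x, g x * convFun k f x = ∫ x, ∫ y, g x * (k (x - y) * f y) := by
        simp only [convFun, integral_const_mul]
    _ = ∫ y, ∫ x, g x * (k (x - y) * f y) :=
        integral_integral_swap (integrable_kernel_triple hk hf hg)
    _ = _ := by
        congr 1
        funext y
        rw [convFun, ← integral_mul_const]
        congr 1
        funext x
        rw [neg_sub]
        ring

/-! ### One-sided exponential kernels -/

/-- The kernel `x ↦ 1_{x > 0} e^{-s x}`. -/
def expKernel (s x : ℝ) : ℂ := (Ioi (0 : ℝ)).indicator (fun x => (Real.exp (-s * x) : ℂ)) x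

lemma norm_ofReal_exp (x : ℝ) : ‖(Real.exp x : ℂ)‖ = Real.exp x := by
  rw [Complex.norm_real, Real.norm_eq_abs, abs_of_pos (Real.exp_pos _)]

lemma isConvKernel_expKernel {s : ℝ} (hs : 0 < s) : IsConvKernel (expKernel s) where
  measurable := Measurable.indicator (by fun_prop) measurableSet_Ioi
  integrable := by
    refine (integrable_indicator_iff measurableSet_Ioi).mpr ?_
    exact (integrableOn_exp_mul_Ioi (a := -s) (by linarith) 0).ofReal
  memLp := by
    refine (memLp_indicator_iff_restrict measurableSet_Ioi).mpr ?_
    rw [memLp_two_iff_integrable_sq_norm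
      (by fun_prop : Continuous fun x : ℝ => (Real.exp (-s * x) : ℂ)).aestronglyMeasurable]
    refine (integrableOn_exp_mul_Ioi (a := -(2 * s)) (by linarith) 0).congr_fun ?_
      measurableSet_Ioi
    intro x hx
    simp only [norm_ofReal_exp, ← Real.exp_nat_mul]
    congr 1
    push_cast
    ring

lemma IsConvKernel.comp_neg {k : ℝ → ℂ} (hk : IsConvKernel k) :
    IsConvKernel (fun x => k (-x)) where
  measurable := hk.measurable.comp measurable_neg
  integrable := hk.integrable.comp_neg
  memLp := hk.memLp.comp_measurePreserving (Measure.measurePreserving_neg volume)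

lemma convFun_comp_neg (k f : ℝ → ℂ) (x : ℝ) :
    convFun (fun t => k (-t)) f x = convFun k (fun y => f (-y)) (-x) := by
  rw [convFun, convFun, ← integral_neg_eq_self]
  congr 1
  funext y
  congr 2
  ring

/-- The factorisation `e^{-s(x-y)} = e^{-sx} e^{sy}` exhibits the convolution as a smooth factor
times a primitive; continuity and the value at `0` are read off from this form. -/
lemma convFun_expKernel (s : ℝ) (f : ℝ → ℂ) (x : ℝ) :
    convFun (expKernel s) f x =
      (Real.exp (-s * x) : ℂ) * ∫ y in Iic x, (Real.exp (s * y) : ℂ) * f y := by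
  rw [integral_Iic_eq_integral_Iio, ← integral_indicator measurableSet_Iio,
    ← integral_const_mul, convFun]
  congr 1
  funext y
  by_cases h : y < x
  · rw [expKernel, indicator_of_mem (by simpa using h), indicator_of_mem (by simpa using h),
      ← mul_assoc, ← Complex.ofReal_mul, ← Real.exp_add]
    congr 4
    ring
  · rw [expKernel, indicator_of_notMem (by simpa using h), indicator_of_notMem (by simpa using h)]
    simp

lemma integrableOn_exp_mul {s : ℝ} (hs : 0 < s) {f : ℝ → ℂ} (hf : MemLp f 2 volume) (x : ℝ) :
    IntegrableOn (fun y => (Real.exp (s * y) : ℂ) * f y) (Iic x) volume := by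
  have h : MemLp (fun y : ℝ => (Real.exp (s * y) : ℂ)) 2 (volume.restrict (Iic x)) := by
    rw [memLp_two_iff_integrable_sq_norm
      (by fun_prop : Continuous fun x : ℝ => (Real.exp (s * x) : ℂ)).aestronglyMeasurable]
    refine (integrableOn_exp_mul_Iic (a := 2 * s) (by positivity) x).congr_fun ?_
      measurableSet_Iic
    intro x hx
    simp only [norm_ofReal_exp, ← Real.exp_nat_mul]
    congr 1
    push_cast
    ring
  exact h.integrable_mul (hf.restrict _)

lemma continuous_convFun_expKernel {s : ℝ} (hs : 0 < s) {f : ℝ → ℂ} (hf : MemLp f 2 volume) :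
    Continuous (convFun (expKernel s) f) := by
  have hint := integrableOn_exp_mul hs hf
  -- The primitive based at `-∞` is a constant plus an interval integral based at `0`, whose
  -- continuity in `x` is standard.
  have e : convFun (expKernel s) f = fun x => (Real.exp (-s * x) : ℂ) *
      ((∫ y in Iic 0, (Real.exp (s * y) : ℂ) * f y) +
        ∫ y in (0 : ℝ)..x, (Real.exp (s * y) : ℂ) * f y) := by
    funext x
    rw [convFun_expKernel, ← intervalIntegral.integral_Iic_sub_Iic (hint 0) (hint x)]
    congr 1
    ring
  rw [e]
  refine Continuous.mul (by fun_prop) (continuous_const.add ?_)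
  refine intervalIntegral.continuous_primitive (fun a b => ?_) 0
  exact (intervalIntegrable_iff.mpr ((hint (max a b)).mono_set fun y hy => hy.2))

lemma continuous_convFun_expKernel_neg {s : ℝ} (hs : 0 < s) {f : ℝ → ℂ}
    (hf : MemLp f 2 volume) : Continuous (convFun (fun t => expKernel s (-t)) f) := by
  have h := continuous_convFun_expKernel hs
    (hf.comp_measurePreserving (Measure.measurePreserving_neg volume))
  refine (h.comp continuous_neg).congr fun x => ?_
  exact (convFun_comp_neg (expKernel s) f x).symm

/-- Integration by parts on `(y, ∞)`: the boundary term at `y` is `-φ(y)`, and differentiating the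
exponential produces the factor `s`. By transposition this gives the weak derivative of the
convolution with an `L²` function. -/
lemma convFun_expKernel_neg_deriv {s : ℝ} {φ : ℝ → ℝ} (h1 : ContDiff ℝ ∞ φ)
    (h2 : HasCompactSupport φ) (y : ℝ) :
    convFun (fun t => expKernel s (-t)) (fun x => ((deriv φ x : ℝ) : ℂ)) y =
      -(φ y : ℂ) + s * convFun (fun t => expKernel s (-t)) (fun x => (φ x : ℂ)) y := by
  have hd : Continuous (deriv φ) := h1.continuous_deriv (by simp)
  have key : ∀ g : ℝ → ℝ, convFun (fun t => expKernel s (-t)) (fun x => (g x : ℂ)) y =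
      ((∫ x in Ioi y, Real.exp (-s * (x - y)) * g x : ℝ) : ℂ) := by
    intro g
    rw [← integral_complex_ofReal, ← integral_indicator measurableSet_Ioi, convFun]
    congr 1
    funext x
    by_cases h : y < x
    · rw [expKernel, indicator_of_mem (by simpa using h), indicator_of_mem (by simpa using h)]
      push_cast
      congr 3
      ring
    · rw [expKernel, indicator_of_notMem (by simpa using h),
        indicator_of_notMem (by simpa using h)]
      simp
  rw [key, key]
  have hint : ∀ g : ℝ → ℝ, Continuous g → HasCompactSupport g →
      Integrable (fun x => Real.exp (-s * (x - y)) * g x) volume := fun g hg hg' =>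
    (by fun_prop : Continuous fun x => Real.exp (-s * (x - y)) * g x).integrable_of_hasCompactSupport
      hg'.mul_left
  have hderiv : ∀ x, HasDerivAt (fun x => Real.exp (-s * (x - y)) * φ x)
      (Real.exp (-s * (x - y)) * deriv φ x - s * (Real.exp (-s * (x - y)) * φ x)) x := by
    intro x
    have hφ := (h1.differentiable (by simp) x).hasDerivAt
    have he : HasDerivAt (fun x => Real.exp (-s * (x - y))) (Real.exp (-s * (x - y)) * (-s)) x := by
      refine HasDerivAt.exp ?_
      simpa using ((hasDerivAt_id x).sub_const y).const_mul (-s)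
    exact (he.mul hφ).congr_deriv (by ring)
  have hI1 := (hint _ hd h2.deriv).integrableOn (s := Ioi y)
  have hI2 := ((hint _ h1.continuous h2).const_mul s).integrableOn (s := Ioi y)
  have hlim : Tendsto (fun x => Real.exp (-s * (x - y)) * φ x) atTop (𝓝 0) := by
    have hc : HasCompactSupport fun x => Real.exp (-s * (x - y)) * φ x := h2.mul_left
    exact (hc.is_zero_at_infty).mono_left atTop_le_cocompact
  have h := integral_Ioi_of_hasDerivAt_of_tendsto
    (by have := h1.continuous; fun_prop : Continuous fun x => Real.exp (-s * (x - y)) * φ x).continuousWithinAt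
    (fun x _ => hderiv x) (hI1.sub hI2) hlim
  rw [integral_sub hI1 hI2, integral_const_mul] at h
  simp only [sub_self, mul_zero, Real.exp_zero, one_mul, zero_sub] at h
  rw [sub_eq_iff_eq_add.mp h]
  push_cast
  ring

lemma convFun_expKernel_deriv {s : ℝ} {φ : ℝ → ℝ} (h1 : ContDiff ℝ ∞ φ)
    (h2 : HasCompactSupport φ) (y : ℝ) :
    convFun (expKernel s) (fun x => ((deriv φ x : ℝ) : ℂ)) y =
      (φ y : ℂ) - s * convFun (expKernel s) (fun x => (φ x : ℂ)) y := by
  -- The opposite one-sided kernel is handled by reflection: the previous identity is applied to `x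
  -- ↦ φ(-x)` at `-y`.
  have h := convFun_expKernel_neg_deriv (s := s) (φ := fun x => φ (-x))
    (h1.comp contDiff_neg) (h2.comp_homeomorph (Homeomorph.neg ℝ)) (-y)
  rw [convFun_comp_neg, convFun_comp_neg] at h
  simp only [neg_neg, deriv_comp_neg] at h
  have e : (fun x => ((-deriv φ x : ℝ) : ℂ)) = (-1 : ℂ) • fun x => ((deriv φ x : ℝ) : ℂ) := by
    funext x; simp
  rw [e, convFun_smul] at h
  simp only [Pi.smul_apply, smul_eq_mul] at h
  linear_combination -h

lemma memLp_test {φ : ℝ → ℝ} (h1 : Continuous φ) (h2 : HasCompactSupport φ) :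
    MemLp (fun x => (φ x : ℂ)) 2 volume := by
  refine Continuous.memLp_of_hasCompactSupport (by fun_prop) ?_
  exact h2.comp_left (g := fun t : ℝ => (t : ℂ)) (by simp)

/-- Convolution with `expKernel s` inverts `d/dx + s`. Since `f` is only in `L²`, the convolution is
transposed onto the test function, where the derivative is classical. -/
lemma hasWeakDeriv_convFun_expKernel {s : ℝ} (hs : 0 < s) {f : ℝ → ℂ} (hf : MemLp f 2 volume) :
    HasWeakDeriv univ (convFun (expKernel s) f)
      (fun x => f x - s * convFun (expKernel s) f x) := by
  intro φ h1 h2 _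
  have hd : Continuous (deriv φ) := h1.continuous_deriv (by simp)
  have hk := isConvKernel_expKernel hs
  have mφ := memLp_test h1.continuous h2
  have md := memLp_test hd h2.deriv
  simp only [Measure.restrict_univ, Complex.real_smul]
  rw [integral_mul_convFun hk hf md]
  have e1 := integral_mul_convFun hk hf mφ
  simp_rw [convFun_expKernel_neg_deriv h1 h2, add_mul, mul_assoc, mul_sub]
  rw [integral_add, integral_sub, integral_const_mul, ← e1]
  · simp_rw [mul_left_comm _ (s : ℂ), integral_const_mul, neg_mul, integral_neg]
    ring
  · exact mφ.integrable_mul hf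
  · simp_rw [mul_left_comm _ (s : ℂ)]
    exact (mφ.integrable_mul (hk.memLp_convFun hf)).const_mul _
  · exact mφ.neg.integrable_mul hf
  · exact ((hk.comp_neg.memLp_convFun mφ).integrable_mul hf).const_mul _

lemma hasWeakDeriv_convFun_expKernel_neg {s : ℝ} (hs : 0 < s) {f : ℝ → ℂ}
    (hf : MemLp f 2 volume) :
    HasWeakDeriv univ (convFun (fun t => expKernel s (-t)) f)
      (fun x => s * convFun (fun t => expKernel s (-t)) f x - f x) := by
  intro φ h1 h2 _
  have hd : Continuous (deriv φ) := h1.continuous_deriv (by simp)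
  have hk := (isConvKernel_expKernel hs).comp_neg
  have mφ := memLp_test h1.continuous h2
  have md := memLp_test hd h2.deriv
  simp only [Measure.restrict_univ, Complex.real_smul]
  rw [integral_mul_convFun hk hf md]
  have e1 := integral_mul_convFun hk hf mφ
  simp only [neg_neg] at e1 ⊢
  simp_rw [convFun_expKernel_deriv h1 h2, sub_mul, mul_assoc, mul_sub]
  rw [integral_sub, integral_sub, integral_const_mul, ← e1]
  · simp_rw [mul_left_comm _ (s : ℂ), integral_const_mul]
    ring
  · simp_rw [mul_left_comm _ (s : ℂ)]
    exact (mφ.integrable_mul (hk.memLp_convFun hf)).const_mul _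
  · exact mφ.integrable_mul hf
  · exact mφ.integrable_mul hf
  · exact (((isConvKernel_expKernel hs).memLp_convFun mφ).integrable_mul hf).const_mul _

/-! ### Weak solutions of first and second order equations -/

lemma setIntegral_test {E : Type*} [NormedAddCommGroup E] [NormedSpace ℝ E] {Ω : Set ℝ}
    {φ : ℝ → ℝ} (h : tsupport φ ⊆ Ω) (u : ℝ → E) :
    ∫ x in Ω, φ x • u x = ∫ x, φ x • u x :=
  setIntegral_eq_integral_of_forall_compl_eq_zero fun x hx => by
    rw [image_eq_zero_of_notMem_tsupport fun hx' => hx (h hx'), zero_smul]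

/-- A test function with zero integral is the derivative of a test function. -/
lemma exists_test_primitive {Ω : Set ℝ} (hΩ : Ω.OrdConnected) {g : ℝ → ℝ}
    (h1 : ContDiff ℝ ∞ g) (h2 : HasCompactSupport g) (h3 : tsupport g ⊆ Ω)
    (h0 : ∫ x, g x = 0) :
    ∃ ψ : ℝ → ℝ, ContDiff ℝ ∞ ψ ∧ HasCompactSupport ψ ∧ tsupport ψ ⊆ Ω ∧ deriv ψ = g := by
  rcases (tsupport g).eq_empty_or_nonempty with he | hne
  · refine ⟨0, contDiff_const, .zero, ?_, ?_⟩
    · simp [tsupport]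
    · rw [tsupport_eq_empty_iff.mp he]
      exact deriv_zero
  have hK : IsCompact (tsupport g) := h2
  set a := sInf (tsupport g)
  set b := sSup (tsupport g)
  have hsub : tsupport g ⊆ Icc a b := fun x hx =>
    ⟨csInf_le hK.bddBelow hx, le_csSup hK.bddAbove hx⟩
  have hab : Icc a b ⊆ Ω := hΩ.out (h3 (hK.sInf_mem hne)) (h3 (hK.sSup_mem hne))
  -- The primitive starts at `a - 1` rather than `a`, so that the half-open interval of integration
  -- contains the whole support once `x > b`.
  have hd : ∀ x, HasDerivAt (fun x => ∫ t in (a - 1)..x, g t) (g x) x := fun x =>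
    intervalIntegral.integral_hasDerivAt_right (h1.continuous.intervalIntegrable _ _)
      h1.continuous.stronglyMeasurable.stronglyMeasurableAtFilter h1.continuous.continuousAt
  have hderiv : deriv (fun x => ∫ t in (a - 1)..x, g t) = g := funext fun x => (hd x).deriv
  -- To the left of `a` nothing has been integrated; to the right of `b` the primitive equals the
  -- total integral, which is zero.
  have hz : ∀ x ∉ Icc a b, ∫ t in (a - 1)..x, g t = 0 := by
    intro x hx
    rcases lt_or_ge x a with hxa | hxa
    · refine intervalIntegral.integral_zero_ae (Eventually.of_forall fun t ht => ?_)
      refine image_eq_zero_of_notMem_tsupport fun ht' => ?_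
      have := (hsub ht').1
      have := ht.2
      have : max (a - 1) x < a := max_lt (by linarith) hxa
      linarith
    · have hbx : b < x := lt_of_not_ge fun h => hx ⟨hxa, h⟩
      rw [intervalIntegral.integral_eq_integral_of_support_subset, h0]
      intro t ht
      have := hsub (subset_tsupport _ ht)
      exact ⟨by linarith [this.1], by linarith [this.2]⟩
  refine ⟨_, contDiff_infty_iff_deriv.mpr ⟨fun x => (hd x).differentiableAt, ?_⟩,
    HasCompactSupport.intro isCompact_Icc hz, ?_, hderiv⟩
  · rw [hderiv]; exact h1
  · refine (closure_minimal (fun x hx => ?_) isClosed_Icc).trans hab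
    by_contra h
    exact hx (hz x h)

/-- The lemma of du Bois-Reymond. -/
lemma HasWeakDeriv.ae_eq_const {Ω : Set ℝ} (hΩ : IsOpen Ω) (hc : Ω.OrdConnected)
    (hne : Ω.Nonempty) {h : ℝ → ℂ} (hl : LocallyIntegrable h (volume.restrict Ω))
    (hw : HasWeakDeriv Ω h 0) : ∃ C : ℂ, h =ᵐ[volume.restrict Ω] fun _ => C := by
  obtain ⟨x₀, hx₀⟩ := hne
  obtain ⟨η, η1, η2, η3, η4, η5⟩ :=
    exists_contDiff_tsupport_subset (n := ⊤) (hΩ.mem_nhds hx₀)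
  have ηpos : 0 < ∫ x, η x := η3.continuous.integral_pos_of_hasCompactSupport_nonneg_nonzero η2
    (fun x => (η4 ⟨x, rfl⟩).1) (x := x₀) (by rw [η5]; exact one_ne_zero)
  have hint : ∀ {φ : ℝ → ℝ}, Continuous φ → HasCompactSupport φ →
      Integrable (fun x => φ x • h x) (volume.restrict Ω) := fun k1 k2 =>
    hl.integrable_smul_left_of_hasCompactSupport k1 k2
  -- Subtracting from `φ` the multiple of the fixed bump `η` with the same integral leaves a test
  -- function of mean zero. It is the derivative of a test function, so `h` annihilates it.
  have key : ∀ φ : ℝ → ℝ, ContDiff ℝ ∞ φ → HasCompactSupport φ → tsupport φ ⊆ Ω →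
      ∫ x in Ω, φ x • h x = ((∫ x, φ x) * (∫ x, η x)⁻¹) • ∫ x in Ω, η x • h x := by
    intro φ h1 h2 h3
    generalize hr : (∫ x, φ x) * (∫ x, η x)⁻¹ = r
    have iφ := h1.continuous.integrable_of_hasCompactSupport (μ := volume) h2
    have iη := η3.continuous.integrable_of_hasCompactSupport (μ := volume) η2
    have hz : ∫ x, (φ x - r * η x) = 0 := by
      rw [integral_sub iφ (iη.const_mul _), integral_const_mul, ← hr, mul_assoc,
        inv_mul_cancel₀ ηpos.ne', mul_one, sub_self]
    have hη : tsupport (fun x => r * η x) ⊆ Ω := (tsupport_mul_subset_right).trans η1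
    obtain ⟨ψ, ψ1, ψ2, ψ3, ψ4⟩ := exists_test_primitive hc (g := fun x => φ x - r * η x)
      (h1.sub (contDiff_const.mul η3)) (h2.sub η2.mul_left)
      ((tsupport_sub _ _).trans (union_subset h3 hη)) hz
    have e := hw ψ ψ1 ψ2 ψ3
    simp only [ψ4, sub_smul, mul_smul, Pi.zero_apply, smul_zero, integral_zero, neg_zero] at e
    have i2 : Integrable (fun x => r • η x • h x) (volume.restrict Ω) :=
      (hint η3.continuous η2).smul r
    rwa [integral_sub (hint h1.continuous h2) i2, integral_smul, sub_eq_zero] at e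
  generalize hJ : ∫ x in Ω, η x • h x = J at key
  generalize hI : (∫ x, η x)⁻¹ = I at key
  -- By `key`, the difference of `h` and the constant `I • J` is annihilated by every test function.
  have key' := hΩ.ae_eq_zero_of_integral_contDiff_smul_eq_zero
    (f := fun x => h x - I • J) (μ := volume.restrict Ω)
    ((hl.sub (locallyIntegrable_const _)).locallyIntegrableOn Ω) (fun φ h1 h2 h3 => by
      simp only [smul_sub]
      rw [integral_sub (hint h1.continuous h2)
        ((h1.continuous.integrable_of_hasCompactSupport h2).smul_const _), key φ h1 h2 h3,
        integral_smul_const, sub_eq_zero, mul_smul]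
      congr 1
      exact (setIntegral_eq_integral_of_forall_compl_eq_zero fun x hx =>
        image_eq_zero_of_notMem_tsupport fun hx' => hx (h3 hx')).symm)
  refine ⟨I • J, ?_⟩
  filter_upwards [key', ae_restrict_mem hΩ.measurableSet] with x hx hm
  exact sub_eq_zero.mp (hx hm)

lemma hasDerivAt_exp_const_mul (c x : ℝ) :
    HasDerivAt (fun x => Real.exp (c * x)) (c * Real.exp (c * x)) x := by
  have h : HasDerivAt (fun x : ℝ => c * x) c x := by
    simpa using (hasDerivAt_id' x).const_mul c
  rw [mul_comm c]
  exact h.exp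

/-- Weak solutions of `u' = c u` are exponentials. -/
lemma HasWeakDeriv.ae_eq_exp {Ω : Set ℝ} (hΩ : IsOpen Ω) (hc : Ω.OrdConnected)
    (hne : Ω.Nonempty) {u : ℝ → ℂ} (hu : MemLp u 2 (volume.restrict Ω)) {c : ℝ}
    (hw : HasWeakDeriv Ω u ((c : ℂ) • u)) :
    ∃ C : ℂ, u =ᵐ[volume.restrict Ω] fun x => C * (Real.exp (c * x) : ℂ) := by
  have hl : LocallyIntegrable (fun x => Real.exp (-c * x) • u x) (volume.restrict Ω) := by
    rw [← locallyIntegrableOn_univ]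
    exact ((hu.locallyIntegrable (by norm_num)).locallyIntegrableOn univ).continuousOn_smul
      isOpen_univ.isLocallyClosed (by fun_prop)
  -- The integrating factor `e^{-cx}` reduces the equation to `h' = 0`. It is absorbed into the test
  -- function: differentiating `φ e^{-cx}` gives an extra term `-c φ e^{-cx}`, which cancels `c u`.
  obtain ⟨C, hC⟩ := HasWeakDeriv.ae_eq_const hΩ hc hne hl (fun φ h1 h2 h3 => by
    have e := hw (fun x => φ x * Real.exp (-c * x)) (h1.mul (by fun_prop)) h2.mul_right
      ((tsupport_mul_subset_left).trans h3)
    have hd : ∀ x, deriv (fun x => φ x * Real.exp (-c * x)) x =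
        deriv φ x * Real.exp (-c * x) - c * (φ x * Real.exp (-c * x)) := by
      intro x
      have hφ := (h1.differentiable (by simp) x).hasDerivAt
      have hm : HasDerivAt (fun x => φ x * Real.exp (-c * x)) _ x :=
        hφ.mul (hasDerivAt_exp_const_mul (-c) x)
      rw [hm.deriv]
      ring
    have i1 : Integrable (fun x => (deriv φ x * Real.exp (-c * x)) • u x)
        (volume.restrict Ω) :=
      integrable_test_smul hu ((h1.continuous_deriv (by simp)).mul (by fun_prop)) h2.deriv.mul_right
    have i2 : Integrable (fun x => (φ x * Real.exp (-c * x)) • u x) (volume.restrict Ω) :=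
      integrable_test_smul hu (h1.continuous.mul (by fun_prop)) h2.mul_right
    simp_rw [hd, sub_smul, mul_smul c] at e
    have i3 : Integrable (fun x => c • (φ x * Real.exp (-c * x)) • u x) (volume.restrict Ω) :=
      i2.smul c
    rw [integral_sub i1 i3, integral_smul] at e
    simp only [Pi.smul_apply, smul_comm _ (c : ℂ)] at e
    rw [integral_smul, Complex.coe_smul] at e
    simp only [smul_smul, Pi.zero_apply, smul_zero, integral_zero, neg_zero]
    rw [sub_eq_iff_eq_add] at e
    rw [e]
    simp)
  refine ⟨C, ?_⟩
  filter_upwards [hC] with x hx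
  rw [← hx, Complex.real_smul, mul_right_comm, ← Complex.ofReal_mul, ← Real.exp_add]
  simp

/-- The exponential is at least `1` on `Ω`, so the constant `C` would itself be square integrable on
a set of infinite measure. -/
lemma eq_zero_of_memLp_exp_of_le {Ω : Set ℝ} {s : ℝ} {C : ℂ} (hm : MeasurableSet Ω)
    (hv : volume Ω = ⊤) (hs : ∀ x ∈ Ω, 0 ≤ s * x)
    (h : MemLp (fun x => C * (Real.exp (s * x) : ℂ)) 2 (volume.restrict Ω)) : C = 0 := by
  have h' : MemLp (fun _ : ℝ => C) 2 (volume.restrict Ω) := by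
    refine h.mono (by fun_prop) ?_
    filter_upwards [ae_restrict_mem hm] with x hx
    rw [norm_mul, norm_ofReal_exp]
    exact le_mul_of_one_le_right (norm_nonneg _) (Real.one_le_exp (hs x hx))
  rcases (memLp_const_iff (by norm_num) (by norm_num)).mp h' with h | h
  · exact h
  · simp [hv] at h

/-- Square integrable weak solutions of `u'' = s² u` are multiples of `e^{-s x}` when `e^{s x}` is
not square integrable. -/
lemma HasWeakDeriv.ae_eq_decaying {Ω : Set ℝ} (hΩ : IsOpen Ω) (hc : Ω.OrdConnected)
    (hne : Ω.Nonempty) {s : ℝ}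
    (hgrow : ∀ C : ℂ, MemLp (fun x => C * (Real.exp (s * x) : ℂ)) 2 (volume.restrict Ω) → C = 0)
    {u v : ℝ → ℂ} (hu : MemLp u 2 (volume.restrict Ω)) (hv : MemLp v 2 (volume.restrict Ω))
    (h1 : HasWeakDeriv Ω u v) (h2 : HasWeakDeriv Ω v (((s : ℂ) ^ 2) • u)) :
    ∃ C : ℂ, (u =ᵐ[volume.restrict Ω] fun x => C * (Real.exp (-s * x) : ℂ)) ∧
      v =ᵐ[volume.restrict Ω] fun x => -s * C * (Real.exp (-s * x) : ℂ) := by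
  -- Factor `u'' - s² u = (d/dx - s)(d/dx + s) u`. The function `u' + s u` is then a multiple of
  -- `e^{sx}`, hence zero by `hgrow`, and `u' = -s u` remains.
  have hw : MemLp (v + (s : ℂ) • u) 2 (volume.restrict Ω) := hv.add (hu.const_smul _)
  have hw' : HasWeakDeriv Ω (v + (s : ℂ) • u) ((s : ℂ) • (v + (s : ℂ) • u)) := by
    have := HasWeakDeriv.add hv (hu.const_smul _) (hu.const_smul (s : ℂ)) (hv.const_smul (s : ℂ))
      h2 (h1.smul s)
    convert this using 1
    rw [smul_add, smul_smul, sq, add_comm]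
  obtain ⟨C, hC⟩ := hw'.ae_eq_exp hΩ hc hne hw
  have hC0 : C = 0 := hgrow C (hw.ae_eq hC)
  have hvu : v =ᵐ[volume.restrict Ω] ((-s : ℝ) : ℂ) • u := by
    filter_upwards [hC] with x hx
    simp only [Pi.add_apply, Pi.smul_apply, smul_eq_mul, hC0, zero_mul] at hx ⊢
    push_cast
    linear_combination hx
  obtain ⟨D, hD⟩ := (h1.congr (ae_eq_refl u) hvu.symm).ae_eq_exp hΩ hc hne hu
  refine ⟨D, hD, ?_⟩
  filter_upwards [hvu, hD] with x hx hx'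
  rw [hx, Pi.smul_apply, hx', smul_eq_mul]
  push_cast
  ring

lemma HasWeakDeriv.ae_eq_decaying_Ioi {s : ℝ} (hs : 0 < s) {u v : ℝ → ℂ}
    (hu : MemLp u 2 (volume.restrict (Ioi 0))) (hv : MemLp v 2 (volume.restrict (Ioi 0)))
    (h1 : HasWeakDeriv (Ioi 0) u v) (h2 : HasWeakDeriv (Ioi 0) v (((s : ℂ) ^ 2) • u)) :
    ∃ C : ℂ, (u =ᵐ[volume.restrict (Ioi 0)] fun x => C * (Real.exp (-s * x) : ℂ)) ∧
      v =ᵐ[volume.restrict (Ioi 0)] fun x => -s * C * (Real.exp (-s * x) : ℂ) :=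
  h1.ae_eq_decaying isOpen_Ioi ordConnected_Ioi nonempty_Ioi (fun _ hC =>
    eq_zero_of_memLp_exp_of_le measurableSet_Ioi (by simp)
      (fun _ hx => mul_nonneg hs.le (le_of_lt hx)) hC) hu hv h2

lemma HasWeakDeriv.ae_eq_decaying_Iio {s : ℝ} (hs : 0 < s) {u v : ℝ → ℂ}
    (hu : MemLp u 2 (volume.restrict (Iio 0))) (hv : MemLp v 2 (volume.restrict (Iio 0)))
    (h1 : HasWeakDeriv (Iio 0) u v) (h2 : HasWeakDeriv (Iio 0) v (((s : ℂ) ^ 2) • u)) :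
    ∃ C : ℂ, (u =ᵐ[volume.restrict (Iio 0)] fun x => C * (Real.exp (s * x) : ℂ)) ∧
      v =ᵐ[volume.restrict (Iio 0)] fun x => s * C * (Real.exp (s * x) : ℂ) := by
  -- The equation involves only `s²`, so replacing `s` by `-s` exchanges the roles of the growing
  -- and the decaying exponential.
  have := h1.ae_eq_decaying isOpen_Iio ordConnected_Iio nonempty_Iio (s := -s) (fun _ hC =>
    eq_zero_of_memLp_exp_of_le measurableSet_Iio (by simp)
      (fun x hx => mul_nonneg_of_nonpos_of_nonpos (by linarith) (le_of_lt hx)) hC) hu hv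
    (by simpa using h2)
  simpa using this

lemma HasWeakDeriv.ae_eq_zero_univ {s : ℝ} (hs : 0 < s) {u v : ℝ → ℂ}
    (hu : MemLp u 2 volume) (hv : MemLp v 2 volume)
    (h1 : HasWeakDeriv univ u v) (h2 : HasWeakDeriv univ v (((s : ℂ) ^ 2) • u)) :
    u =ᵐ[volume] 0 := by
  obtain ⟨C, hC, -⟩ := h1.ae_eq_decaying isOpen_univ ordConnected_univ univ_nonempty (s := s)
    (fun _ hC => eq_zero_of_memLp_exp_of_le measurableSet_Ioi (by simp)
      (fun _ hx => mul_nonneg hs.le (le_of_lt hx))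
      ((Measure.restrict_univ (μ := (volume : Measure ℝ)) ▸ hC).restrict (Ioi 0)))
    (by simpa using hu) (by simpa using hv) h2
  rw [Measure.restrict_univ] at hC
  -- The behaviour at `+∞` has excluded `e^{sx}`; the surviving `e^{-sx}` is excluded by its growth
  -- at `-∞`.
  have hC0 : C = 0 := eq_zero_of_memLp_exp_of_le (s := -s) measurableSet_Iio (by simp)
    (fun x hx => mul_nonneg_of_nonpos_of_nonpos (by linarith) (le_of_lt hx))
    ((hu.ae_eq hC).restrict (Iio 0))
  filter_upwards [hC] with x hx
  simp [hx, hC0]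

/-! ### Resolvents from graphs -/

section Spectral

variable {H : Type*} [NormedAddCommGroup H] [InnerProductSpace ℂ H]

/-- A right inverse together with injectivity of `T - z` suffices: `R (T - z) u - u` lies in the
kernel of `T - z`. Working with graphs avoids carrying proofs of domain membership. -/
lemma isResolventAt_of_graph {T : H →ₗ.[ℂ] H} {z : ℂ} {R : H →L[ℂ] H}
    (h1 : ∀ f, (R f, f + z • R f) ∈ T.graph) (h2 : ∀ u, (u, z • u) ∈ T.graph → u = 0) :
    IsResolventAt T z R := by
  refine ⟨fun f => ?_, fun u => ?_⟩
  · obtain ⟨y, hy, hy'⟩ := (LinearPMap.mem_graph_iff T).mp (h1 f)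
    simp only at hy hy'
    have hm : R f ∈ T.domain := hy ▸ y.2
    refine ⟨hm, ?_⟩
    have e : (⟨R f, hm⟩ : T.domain) = y := Subtype.ext hy.symm
    rw [e, hy', add_sub_cancel_right]
  · have h := T.graph.sub_mem (h1 (T u - z • (u : H))) (T.mem_graph u)
    have e := h2 (R (T u - z • (u : H)) - u) (by
      convert h using 1
      ext
      · rfl
      · simp [smul_sub]
        abel)
    exact sub_eq_zero.mp e

end Spectral

/-! ### The resolvent of the Laplacian on the line -/

/-- The function `x ↦ ∫ e^{-s|x-y|} f(y) dy / (2s)`. -/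
def greenFun (s : ℝ) (f : ℝ → ℂ) (x : ℝ) : ℂ :=
  (1 / (2 * s) : ℂ) * (convFun (expKernel s) f x + convFun (fun t => expKernel s (-t)) f x)

/-- The derivative of `greenFun s f`. -/
def greenDeriv (s : ℝ) (f : ℝ → ℂ) (x : ℝ) : ℂ :=
  (1 / 2 : ℂ) * (convFun (fun t => expKernel s (-t)) f x - convFun (expKernel s) f x)

lemma continuous_greenFun {s : ℝ} (hs : 0 < s) {f : ℝ → ℂ} (hf : MemLp f 2 volume) :
    Continuous (greenFun s f) :=
  continuous_const.mul
    ((continuous_convFun_expKernel hs hf).add (continuous_convFun_expKernel_neg hs hf))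

lemma continuous_greenDeriv {s : ℝ} (hs : 0 < s) {f : ℝ → ℂ} (hf : MemLp f 2 volume) :
    Continuous (greenDeriv s f) :=
  continuous_const.mul
    ((continuous_convFun_expKernel_neg hs hf).sub (continuous_convFun_expKernel hs hf))

lemma memLp_greenDeriv {s : ℝ} (hs : 0 < s) {f : ℝ → ℂ} (hf : MemLp f 2 volume) :
    MemLp (greenDeriv s f) 2 volume :=
  (((isConvKernel_expKernel hs).comp_neg.memLp_convFun hf).sub
    ((isConvKernel_expKernel hs).memLp_convFun hf)).const_mul _

/-- The two one-sided convolutions satisfy `A' = f - s A` and `B' = s B - f`. The source cancels in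
`A + B`, which is why the first derivative is again continuous; it survives in `B - A` and produces
`-f` in the second derivative. -/
lemma hasWeakDeriv_greenFun {s : ℝ} (hs : 0 < s) {f : ℝ → ℂ} (hf : MemLp f 2 volume) :
    HasWeakDeriv univ (greenFun s f) (greenDeriv s f) := by
  have hA := (isConvKernel_expKernel hs).memLp_convFun hf
  have hB := (isConvKernel_expKernel hs).comp_neg.memLp_convFun hf
  have h := (HasWeakDeriv.add (hA.restrict _) ((hf.sub (hA.const_mul _)).restrict _)
    (hB.restrict _) (((hB.const_mul _).sub hf).restrict _)
    (hasWeakDeriv_convFun_expKernel hs hf)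
    (hasWeakDeriv_convFun_expKernel_neg hs hf)).smul (1 / (2 * s) : ℂ)
  have : (s : ℂ) ≠ 0 := by exact_mod_cast hs.ne'
  refine h.congr (Eventually.of_forall fun _ => rfl) (Eventually.of_forall fun x => ?_)
  simp only [greenDeriv, Pi.smul_apply, Pi.add_apply, Pi.sub_apply, smul_eq_mul]
  field_simp
  ring

lemma hasWeakDeriv_greenDeriv {s : ℝ} (hs : 0 < s) {f : ℝ → ℂ} (hf : MemLp f 2 volume) :
    HasWeakDeriv univ (greenDeriv s f) (fun x => (s : ℂ) ^ 2 * greenFun s f x - f x) := by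
  have hA := (isConvKernel_expKernel hs).memLp_convFun hf
  have hB := (isConvKernel_expKernel hs).comp_neg.memLp_convFun hf
  have h := HasWeakDeriv.add ((hB.const_smul _).restrict _)
    ((((hB.const_mul _).sub hf).const_smul _).restrict _) ((hA.const_smul _).restrict _)
    (((hf.sub (hA.const_mul _)).const_smul _).restrict _)
    ((hasWeakDeriv_convFun_expKernel_neg hs hf).smul (1 / 2 : ℂ))
    ((hasWeakDeriv_convFun_expKernel hs hf).smul (-1 / 2 : ℂ))
  have : (s : ℂ) ≠ 0 := by exact_mod_cast hs.ne'
  convert h using 1 <;> funext x <;>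
    simp only [greenFun, greenDeriv, Pi.smul_apply, Pi.add_apply, Pi.sub_apply, smul_eq_mul]
  · ring
  · field_simp
    ring

/-- The resolvent of `-Δ` on the line at `-s²`. -/
def lineResolvent {s : ℝ} (hs : 0 < s) : L2Line →L[ℂ] L2Line :=
  (1 / (2 * s) : ℂ) • (convCLM _ (isConvKernel_expKernel hs) +
    convCLM _ (isConvKernel_expKernel hs).comp_neg)

lemma lineResolvent_coeFn {s : ℝ} (hs : 0 < s) (f : L2Line) :
    lineResolvent hs f =ᵐ[volume] greenFun s f := by
  have e : lineResolvent hs f = (1 / (2 * s) : ℂ) • (convCLM _ (isConvKernel_expKernel hs) f +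
    convCLM _ (isConvKernel_expKernel hs).comp_neg f) := rfl
  rw [e]
  filter_upwards [Lp.coeFn_smul (1 / (2 * s) : ℂ) (convCLM _ (isConvKernel_expKernel hs) f +
    convCLM _ (isConvKernel_expKernel hs).comp_neg f),
    Lp.coeFn_add (convCLM _ (isConvKernel_expKernel hs) f)
      (convCLM _ (isConvKernel_expKernel hs).comp_neg f),
    convCLM_coeFn _ (isConvKernel_expKernel hs) f,
    convCLM_coeFn _ (isConvKernel_expKernel hs).comp_neg f] with x h1 h2 h3 h4
  rw [h1, Pi.smul_apply, h2, Pi.add_apply, h3, h4]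
  rfl

lemma isResolventAt_lineResolvent {s : ℝ} (hs : 0 < s) :
    IsResolventAt lineLaplacian ((-s ^ 2 : ℝ) : ℂ) (lineResolvent hs) := by
  refine isResolventAt_of_graph (fun f => ?_) (fun u hu => ?_)
  · rw [lineLaplacian_graph]
    have hf := Lp.memLp f
    have hv := MemLp.coeFn_toLp (memLp_greenDeriv hs hf)
    refine ⟨(memLp_greenDeriv hs hf).toLp, (hasWeakDeriv_greenFun hs hf).congr ?_ ?_,
      (hasWeakDeriv_greenDeriv hs hf).congr ?_ ?_⟩ <;> rw [Measure.restrict_univ]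
    · exact lineResolvent_coeFn hs f
    · exact hv
    · exact hv
    · filter_upwards [lineResolvent_coeFn hs f,
        Lp.coeFn_neg (f + ((-s ^ 2 : ℝ) : ℂ) • lineResolvent hs f),
        Lp.coeFn_add f (((-s ^ 2 : ℝ) : ℂ) • lineResolvent hs f),
        Lp.coeFn_smul ((-s ^ 2 : ℝ) : ℂ) (lineResolvent hs f)] with x h1 h2 h3 h4
      simp only [h2, h3, h4, Pi.neg_apply, Pi.add_apply, Pi.smul_apply, h1, smul_eq_mul]
      push_cast
      ring
  · rw [lineLaplacian_graph] at hu
    obtain ⟨v, h1, h2⟩ := hu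
    have e : (-(((-s ^ 2 : ℝ) : ℂ) • u) : L2Line) = ((s : ℂ) ^ 2) • u := by
      rw [← neg_smul]; push_cast; rw [neg_neg]
    have h3 := HasWeakDeriv.ae_eq_zero_univ hs (Lp.memLp u) (Lp.memLp v) h1
      (h2.congr (ae_eq_refl _) (by
        rw [Measure.restrict_univ]
        simp only [e]
        exact (Lp.coeFn_smul _ u).symm))
    exact Lp.ext (h3.trans (Lp.coeFn_zero _ _ _).symm)

/-! ### Symmetry of the resolvent on the line. -/

lemma conj_expKernel (s x : ℝ) : (starRingEnd ℂ) (expKernel s x) = expKernel s x := by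
  by_cases h : x ∈ Ioi (0 : ℝ)
  · rw [expKernel, indicator_of_mem h, Complex.conj_ofReal]
  · rw [expKernel, indicator_of_notMem h, map_zero]

lemma inner_convCLM {k : ℝ → ℂ} (hk : IsConvKernel k) (hr : ∀ x, (starRingEnd ℂ) (k x) = k x)
    (f g : L2Line) :
    inner ℂ (convCLM k hk f) g = inner ℂ f (convCLM _ hk.comp_neg g) := by
  have hfc : MemLp (fun x => (starRingEnd ℂ) (f x)) 2 volume := (Lp.memLp f).star
  have hconj : ∀ x, (starRingEnd ℂ) (convFun k f x) = convFun k (fun y => (starRingEnd ℂ) (f y)) x := by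
    intro x
    rw [convFun, convFun, ← integral_conj]
    simp only [map_mul, hr]
  rw [L2.inner_def, L2.inner_def]
  calc ∫ x, inner ℂ (convCLM k hk f x) (g x)
      = ∫ x, g x * convFun k (fun y => (starRingEnd ℂ) (f y)) x := by
        refine integral_congr_ae ?_
        filter_upwards [convCLM_coeFn k hk f] with x hx
        rw [hx, RCLike.inner_apply, hconj]
    _ = ∫ y, convFun (fun t => k (-t)) g y * (starRingEnd ℂ) (f y) :=
        integral_mul_convFun hk hfc (Lp.memLp g)
    _ = _ := by
        refine integral_congr_ae ?_
        filter_upwards [convCLM_coeFn _ hk.comp_neg g] with x hx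
        rw [hx, RCLike.inner_apply]

/-- The two one-sided convolutions are adjoint to each other, so their sum with a real coefficient
is symmetric. -/
lemma inner_lineResolvent {s : ℝ} (hs : 0 < s) (f g : L2Line) :
    inner ℂ (lineResolvent hs f) g = inner ℂ f (lineResolvent hs g) := by
  have h1 := inner_convCLM (isConvKernel_expKernel hs) (conj_expKernel s)
  have h2 : ∀ f g : L2Line, inner ℂ (convCLM _ (isConvKernel_expKernel hs).comp_neg f) g =
      inner ℂ f (convCLM _ (isConvKernel_expKernel hs) g) := fun f g => by
    rw [← inner_conj_symm, ← h1, inner_conj_symm]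
  simp only [lineResolvent, smul_apply, add_apply,
    inner_smul_left, inner_smul_right, inner_add_left, inner_add_right, h1, h2]
  have : (starRingEnd ℂ) (1 / (2 * s)) = 1 / (2 * (s : ℂ)) := by simp [Complex.conj_ofNat]
  rw [this]
  ring

/-! ### Restriction and extension by zero -/

lemma restrictTo_coeFn (Ω : Set ℝ) (v : L2Line) : restrictTo Ω v =ᵐ[volume.restrict Ω] v :=
  MemLp.coeFn_toLp ((Lp.memLp v).restrict Ω)

/-- Restriction to `Ω` as a bounded operator. -/
def restrictCLM (Ω : Set ℝ) : L2Line →L[ℂ] L2 Ω :=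
  LinearMap.mkContinuous
    { toFun := restrictTo Ω
      map_add' := fun u v => by
        rw [restrictTo, restrictTo, restrictTo, ← MemLp.toLp_add]
        exact MemLp.toLp_congr _ _ (ae_restrict_of_ae (Lp.coeFn_add u v))
      map_smul' := fun c u => by
        rw [restrictTo, restrictTo, RingHom.id_apply, ← MemLp.toLp_const_smul]
        exact MemLp.toLp_congr _ _ (ae_restrict_of_ae (Lp.coeFn_smul c u)) }
    1
    (fun u => by
      simp only [LinearMap.coe_mk, AddHom.coe_mk, restrictTo, Lp.norm_toLp, one_mul]
      exact ENNReal.toReal_mono (Lp.eLpNorm_ne_top u) (eLpNorm_mono_measure _ Measure.restrict_le_self))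

lemma memLp_indicator_coeFn {Ω : Set ℝ} (hΩ : MeasurableSet Ω) (u : L2 Ω) :
    MemLp (Ω.indicator u) 2 volume :=
  (memLp_indicator_iff_restrict hΩ).mpr (Lp.memLp u)

/-- The extension by zero of an element of `L²(Ω)`. -/
def extendBy {Ω : Set ℝ} (hΩ : MeasurableSet Ω) (u : L2 Ω) : L2Line :=
  MemLp.toLp (Ω.indicator u) (memLp_indicator_coeFn hΩ u)

lemma extendBy_coeFn {Ω : Set ℝ} (hΩ : MeasurableSet Ω) (u : L2 Ω) :
    extendBy hΩ u =ᵐ[volume] Ω.indicator u :=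
  MemLp.coeFn_toLp (memLp_indicator_coeFn hΩ u)

/-- Extension by zero as a bounded operator. -/
def extendCLM {Ω : Set ℝ} (hΩ : MeasurableSet Ω) : L2 Ω →L[ℂ] L2Line :=
  LinearMap.mkContinuous
    { toFun := extendBy hΩ
      map_add' := fun u v => by
        rw [extendBy, extendBy, extendBy, ← MemLp.toLp_add]
        refine MemLp.toLp_congr _ _ ?_
        filter_upwards [(ae_restrict_iff' hΩ).mp (Lp.coeFn_add u v)] with x hx
        by_cases h : x ∈ Ω
        · rw [Pi.add_apply, indicator_of_mem h, indicator_of_mem h, indicator_of_mem h]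
          exact hx h
        · simp [h]
      map_smul' := fun c u => by
        rw [extendBy, extendBy, RingHom.id_apply, ← MemLp.toLp_const_smul]
        refine MemLp.toLp_congr _ _ ?_
        filter_upwards [(ae_restrict_iff' hΩ).mp (Lp.coeFn_smul c u)] with x hx
        by_cases h : x ∈ Ω
        · simp [h, hx h]
        · simp [h] }
    1
    (fun u => by
      simp only [LinearMap.coe_mk, AddHom.coe_mk, extendBy, Lp.norm_toLp, one_mul]
      rw [eLpNorm_indicator_eq_eLpNorm_restrict hΩ, Lp.norm_def])

lemma inner_extendCLM {Ω : Set ℝ} (hΩ : MeasurableSet Ω) (u : L2 Ω) (v : L2Line) :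
    inner ℂ (extendCLM hΩ u) v = inner ℂ u (restrictTo Ω v) := by
  rw [L2.inner_def, L2.inner_def, ← integral_indicator hΩ]
  have h := (ae_restrict_iff' hΩ).mp (restrictTo_coeFn Ω v)
  refine integral_congr_ae ?_
  filter_upwards [extendBy_coeFn hΩ u, h] with x h1 h2
  change inner ℂ (extendBy hΩ u x) (v x) = _
  rw [h1]
  by_cases hx : x ∈ Ω
  · rw [indicator_of_mem hx, indicator_of_mem hx, h2 hx]
  · rw [indicator_of_notMem hx, indicator_of_notMem hx, inner_zero_left]

/-- `split` as a bounded operator. -/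
def splitCLM : L2Line →L[ℂ] TwoSided :=
  ((WithLp.prodContinuousLinearEquiv 2 ℂ (L2 (Iio 0)) (L2 (Ioi 0))).symm :
    L2 (Iio 0) × L2 (Ioi 0) →L[ℂ] TwoSided) ∘L
    ((restrictCLM (Iio 0)).prod (restrictCLM (Ioi 0)))

lemma splitCLM_apply (v : L2Line) : splitCLM v = split v := rfl

/-- `glue` as a bounded operator. -/
def glueCLM : TwoSided →L[ℂ] L2Line :=
  extendCLM measurableSet_Iio ∘L WithLp.fstL 2 ℂ (L2 (Iio 0)) (L2 (Ioi 0)) +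
    extendCLM measurableSet_Ioi ∘L WithLp.sndL 2 ℂ (L2 (Iio 0)) (L2 (Ioi 0))

lemma glueCLM_apply (u : TwoSided) : glueCLM u = glue u :=
  (MemLp.toLp_add (memLp_indicator_coeFn measurableSet_Iio u.fst)
    (memLp_indicator_coeFn measurableSet_Ioi u.snd)).symm

lemma glue_coeFn (u : TwoSided) : glue u =ᵐ[volume]
    fun x => (Iio (0 : ℝ)).indicator u.fst x + (Ioi (0 : ℝ)).indicator u.snd x :=
  MemLp.coeFn_toLp ((memLp_indicator_coeFn measurableSet_Iio u.fst).add
    (memLp_indicator_coeFn measurableSet_Ioi u.snd))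

/-- Gluing and splitting are adjoint, so conjugation by them carries the symmetry of the line
resolvent over to the two-sided space. -/
lemma inner_glueCLM (u : TwoSided) (v : L2Line) :
    inner ℂ (glueCLM u) v = inner ℂ u (splitCLM v) := by
  rw [WithLp.prod_inner_apply]
  change inner ℂ (extendCLM measurableSet_Iio u.fst + extendCLM measurableSet_Ioi u.snd) v = _
  rw [inner_add_left, inner_extendCLM, inner_extendCLM]
  rfl

lemma glue_ae_Iio (u : TwoSided) : glue u =ᵐ[volume.restrict (Iio 0)] u.fst := by
  filter_upwards [ae_restrict_of_ae (glue_coeFn u), ae_restrict_mem measurableSet_Iio] with x h1 h2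
  rw [h1, indicator_of_mem h2, indicator_of_notMem (by simpa using le_of_lt h2), add_zero]

lemma glue_ae_Ioi (u : TwoSided) : glue u =ᵐ[volume.restrict (Ioi 0)] u.snd := by
  filter_upwards [ae_restrict_of_ae (glue_coeFn u), ae_restrict_mem measurableSet_Ioi] with x h1 h2
  rw [h1, indicator_of_mem h2, indicator_of_notMem (by simpa using le_of_lt h2), zero_add]

lemma twoSided_ext {u v : TwoSided} (h1 : u.fst =ᵐ[volume.restrict (Iio 0)] v.fst)
    (h2 : u.snd =ᵐ[volume.restrict (Ioi 0)] v.snd) : u = v :=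
  WithLp.ofLp_injective 2 (Prod.ext (Lp.ext h1) (Lp.ext h2))

lemma split_glue (u : TwoSided) : split (glue u) = u :=
  twoSided_ext ((restrictTo_coeFn _ _).trans (glue_ae_Iio u))
    ((restrictTo_coeFn _ _).trans (glue_ae_Ioi u))

/-! ### The resolvent of the barrier operator -/

/-- The element `(-ℓ₋, ℓ₊)` with `ℓ(x) = e^{-s|x|}`. -/
def oddExp {s : ℝ} (hs : 0 < s) : TwoSided :=
  WithLp.toLp 2 (-expAbs (Iio 0) hs, expAbs (Ioi 0) hs)

lemma expAbs_coeFn (Ω : Set ℝ) {s : ℝ} (hs : 0 < s) :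
    expAbs Ω hs =ᵐ[volume.restrict Ω] fun x => (Real.exp (-s * |x|) : ℂ) :=
  MemLp.coeFn_toLp ((memLp_exp_abs hs).restrict Ω)

lemma expAbs_ae_Iio {s : ℝ} (hs : 0 < s) :
    expAbs (Iio 0) hs =ᵐ[volume.restrict (Iio 0)] fun x => (Real.exp (s * x) : ℂ) := by
  filter_upwards [expAbs_coeFn (Iio 0) hs, ae_restrict_mem measurableSet_Iio] with x h1 h2
  rw [h1, abs_of_neg h2, neg_mul_neg]

lemma expAbs_ae_Ioi {s : ℝ} (hs : 0 < s) :
    expAbs (Ioi 0) hs =ᵐ[volume.restrict (Ioi 0)] fun x => (Real.exp (-s * x) : ℂ) := by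
  filter_upwards [expAbs_coeFn (Ioi 0) hs, ae_restrict_mem measurableSet_Ioi] with x h1 h2
  rw [h1, abs_of_pos h2]

/-- The coefficient of the rank-one part of the resolvent. -/
def rankOneCoeff (κ s : ℝ) : ℝ := 1 / (2 * (s + 2 * κ))

/-- The resolvent of `T₀` at `-s²`, when `s + 2 κ ≠ 0`. -/
def barrierResolvent (κ : ℝ) {s : ℝ} (hs : 0 < s) : TwoSided →L[ℂ] TwoSided :=
  splitCLM ∘L lineResolvent hs ∘L glueCLM +
    (rankOneCoeff κ s : ℂ) • (innerSL ℂ (oddExp hs)).smulRight (oddExp hs)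

lemma barrierResolvent_apply (κ : ℝ) {s : ℝ} (hs : 0 < s) (f : TwoSided) :
    barrierResolvent κ hs f = split (lineResolvent hs (glue f)) +
      (rankOneCoeff κ s : ℂ) • (inner ℂ (oddExp hs) f • oddExp hs) := by
  rw [← glueCLM_apply]; rfl

lemma inner_oddExp {s : ℝ} (hs : 0 < s) (f : TwoSided) :
    inner ℂ (oddExp hs) f =
      inner ℂ (expAbs (Ioi 0) hs) f.snd - inner ℂ (expAbs (Iio 0) hs) f.fst := by
  rw [WithLp.prod_inner_apply]
  simp only [oddExp, inner_neg_left]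
  exact neg_add_eq_sub _ _

/-- The sign pattern of the matrix is that of `(-ℓ₋, ℓ₊)` paired with itself, so the perturbation
has rank one. -/
lemma barrierPerturbation_eq {s : ℝ} (hs : 0 < s) (f : TwoSided) :
    barrierPerturbation hs f = inner ℂ (oddExp hs) f • oddExp hs := by
  rw [inner_oddExp]
  refine WithLp.ofLp_injective 2 (Prod.ext ?_ ?_)
  · simp only [barrierPerturbation, oddExp, WithLp.ofLp_smul, Prod.smul_fst]
    module
  · simp only [barrierPerturbation, oddExp, WithLp.ofLp_smul, Prod.smul_snd]
    module

lemma inner_barrierResolvent (κ : ℝ) {s : ℝ} (hs : 0 < s) (f g : TwoSided) :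
    inner ℂ (barrierResolvent κ hs f) g = inner ℂ f (barrierResolvent κ hs g) := by
  simp only [barrierResolvent_apply, inner_add_left, inner_add_right, inner_smul_left,
    inner_smul_right, inner_conj_symm, Complex.conj_ofReal]
  have h : inner ℂ (split (lineResolvent hs (glue f))) g =
      inner ℂ f (split (lineResolvent hs (glue g))) := by
    rw [← splitCLM_apply, ← splitCLM_apply, ← inner_conj_symm, ← inner_glueCLM, inner_conj_symm,
      ← inner_glueCLM, glueCLM_apply, glueCLM_apply, inner_lineResolvent]
  rw [h]
  ring

/-! ### Weak derivatives and boundary values at the barrier. -/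

lemma HasWeakDeriv.mono_of_subset {Ω Ω' : Set ℝ} (h : Ω ⊆ Ω') {u w : ℝ → ℂ}
    (hw : HasWeakDeriv Ω' u w) : HasWeakDeriv Ω u w := by
  intro φ h1 h2 h3
  have hd : tsupport (deriv φ) ⊆ Ω := (closure_mono (support_deriv_subset)).trans
    ((closure_closure (s := Function.support φ)).subset.trans h3)
  have := hw φ h1 h2 (h3.trans h)
  rwa [setIntegral_test (hd.trans h), setIntegral_test (h3.trans h), ← setIntegral_test hd,
    ← setIntegral_test h3] at this

lemma hasWeakDeriv_of_hasDerivAt {Ω : Set ℝ} {u w : ℝ → ℂ} (h : ∀ x, HasDerivAt u (w x) x)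
    (hw : Continuous w) : HasWeakDeriv Ω u w := by
  refine HasWeakDeriv.mono_of_subset (subset_univ Ω) fun φ h1 h2 _ => ?_
  have hu : Continuous u := continuous_iff_continuousAt.mpr fun x => (h x).continuousAt
  have hd : Continuous (deriv φ) := h1.continuous_deriv (by simp)
  have hφ : Continuous φ := h1.continuous
  have e := integral_mul_deriv_eq_deriv_mul_of_integrable (u := fun x => (φ x : ℂ))
    (u' := fun x => ((deriv φ x : ℝ) : ℂ)) (v := u) (v' := w)
    (fun x _ => (h1.differentiable (by simp) x).hasDerivAt.ofReal_comp) (fun x _ => h x)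
    ((by fun_prop : Continuous ((fun x => (φ x : ℂ)) * w)).integrable_of_hasCompactSupport
      ((h2.comp_left (g := fun t : ℝ => (t : ℂ)) (by simp)).mul_right))
    ((by fun_prop : Continuous ((fun x => ((deriv φ x : ℝ) : ℂ)) * u)).integrable_of_hasCompactSupport
      ((h2.deriv.comp_left (g := fun t : ℝ => (t : ℂ)) (by simp)).mul_right))
    ((by fun_prop : Continuous ((fun x => (φ x : ℂ)) * u)).integrable_of_hasCompactSupport
      ((h2.comp_left (g := fun t : ℝ => (t : ℂ)) (by simp)).mul_right))
  simp only [Measure.restrict_univ, Complex.real_smul]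
  rw [e, neg_neg]

lemma hasTraceAtZero_of_continuous {Ω : Set ℝ} {u g : ℝ → ℂ} (hg : Continuous g)
    (h : u =ᵐ[volume.restrict Ω] g) : HasTraceAtZero Ω u (g 0) :=
  ⟨g, hg.continuousOn, h, rfl⟩

lemma hasDerivAt_ofReal_exp_mul (c x : ℝ) :
    HasDerivAt (fun x : ℝ => (Real.exp (c * x) : ℂ)) (c * (Real.exp (c * x) : ℂ)) x := by
  simpa using (hasDerivAt_exp_const_mul c x).ofReal_comp

lemma hasWeakDeriv_expAbs_Iio {s : ℝ} (hs : 0 < s) :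
    HasWeakDeriv (Iio 0) (expAbs (Iio 0) hs) ((s : ℂ) • expAbs (Iio 0) hs : L2 (Iio 0)) := by
  refine (hasWeakDeriv_of_hasDerivAt (hasDerivAt_ofReal_exp_mul s) (by fun_prop)).congr
    (expAbs_ae_Iio hs) ?_
  filter_upwards [expAbs_ae_Iio hs, Lp.coeFn_smul (s : ℂ) (expAbs (Iio 0) hs)] with x h1 h2
  rw [h2, Pi.smul_apply, h1, smul_eq_mul]

lemma hasWeakDeriv_expAbs_Ioi {s : ℝ} (hs : 0 < s) :
    HasWeakDeriv (Ioi 0) (expAbs (Ioi 0) hs) ((-s : ℂ) • expAbs (Ioi 0) hs : L2 (Ioi 0)) := by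
  refine (hasWeakDeriv_of_hasDerivAt (hasDerivAt_ofReal_exp_mul (-s)) (by fun_prop)).congr
    (expAbs_ae_Ioi hs) ?_
  filter_upwards [expAbs_ae_Ioi hs, Lp.coeFn_smul (-s : ℂ) (expAbs (Ioi 0) hs)] with x h1 h2
  rw [h2, Pi.smul_apply, h1, smul_eq_mul]
  push_cast
  rfl

lemma hasTraceAtZero_expAbs_Iio {s : ℝ} (hs : 0 < s) :
    HasTraceAtZero (Iio 0) (expAbs (Iio 0) hs) 1 := by
  simpa using hasTraceAtZero_of_continuous (by fun_prop) (expAbs_ae_Iio hs)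

lemma hasTraceAtZero_expAbs_Ioi {s : ℝ} (hs : 0 < s) :
    HasTraceAtZero (Ioi 0) (expAbs (Ioi 0) hs) 1 := by
  simpa using hasTraceAtZero_of_continuous (by fun_prop) (expAbs_ae_Ioi hs)

lemma convFun_expKernel_zero {s : ℝ} (hs : 0 < s) (f : TwoSided) :
    convFun (expKernel s) (glue f) 0 = inner ℂ (expAbs (Iio 0) hs) f.fst := by
  rw [convFun_expKernel, integral_Iic_eq_integral_Iio, L2.inner_def]
  simp only [mul_zero, Real.exp_zero, Complex.ofReal_one, one_mul]
  refine integral_congr_ae ?_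
  filter_upwards [glue_ae_Iio f, expAbs_ae_Iio hs] with x h1 h2
  rw [h1, h2, RCLike.inner_apply, Complex.conj_ofReal, mul_comm]

lemma convFun_expKernel_neg_zero {s : ℝ} (hs : 0 < s) (f : TwoSided) :
    convFun (fun t => expKernel s (-t)) (glue f) 0 = inner ℂ (expAbs (Ioi 0) hs) f.snd := by
  rw [convFun, L2.inner_def, ← integral_indicator measurableSet_Ioi]
  refine integral_congr_ae ?_
  filter_upwards [(ae_restrict_iff' measurableSet_Ioi).mp (glue_ae_Ioi f),
    (ae_restrict_iff' measurableSet_Ioi).mp (expAbs_ae_Ioi hs)] with x h1 h2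
  simp only [zero_sub, neg_neg]
  by_cases hx : x ∈ Ioi 0
  · rw [expKernel, indicator_of_mem hx, indicator_of_mem hx, h1 hx, h2 hx, RCLike.inner_apply,
      Complex.conj_ofReal, mul_comm]
  · rw [expKernel, indicator_of_notMem hx, indicator_of_notMem hx, zero_mul]

/-- At `x = 0` the two one-sided convolutions are the pairings of `f` with `ℓ` on either side. Thus
the derivative of the line solution at the barrier, which fixes the size of the correction, is a
pairing with `oddExp` itself. -/
lemma inner_oddExp_eq {s : ℝ} (hs : 0 < s) (f : TwoSided) :
    inner ℂ (oddExp hs) f = 2 * greenDeriv s (glue f) 0 := by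
  rw [inner_oddExp, ← convFun_expKernel_zero, ← convFun_expKernel_neg_zero, greenDeriv]
  ring

/-- The derivative of `oddExp`, away from the barrier. -/
def oddExpDeriv {s : ℝ} (hs : 0 < s) : TwoSided :=
  WithLp.toLp 2 (-((s : ℂ) • expAbs (Iio 0) hs), (-s : ℂ) • expAbs (Ioi 0) hs)

lemma HasWeakDeriv.neg_Lp {Ω : Set ℝ} {u w : L2 Ω} (h : HasWeakDeriv Ω u w) :
    HasWeakDeriv Ω (-u : L2 Ω) (-w : L2 Ω) := by
  have := h.smul_Lp (-1)
  rwa [neg_one_smul, neg_one_smul] at this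

lemma HasTraceAtZero.neg_Lp {Ω : Set ℝ} {u : L2 Ω} {c : ℂ} (h : HasTraceAtZero Ω u c) :
    HasTraceAtZero Ω (-u : L2 Ω) (-c) := by
  have := h.smul_Lp (-1)
  rwa [neg_one_smul, neg_one_mul] at this

lemma hasWeakDeriv_restrictTo {Ω : Set ℝ} {u w : ℝ → ℂ} {U W : L2Line} (h : HasWeakDeriv univ u w)
    (hu : U =ᵐ[volume] u) (hw : W =ᵐ[volume] w) :
    HasWeakDeriv Ω (restrictTo Ω U) (restrictTo Ω W) :=
  (h.mono_of_subset (subset_univ Ω)).congr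
    ((restrictTo_coeFn Ω U).trans (ae_restrict_of_ae hu))
    ((restrictTo_coeFn Ω W).trans (ae_restrict_of_ae hw))

lemma hasTraceAtZero_restrictTo {Ω : Set ℝ} {u : ℝ → ℂ} {U : L2Line} (h : Continuous u)
    (hu : U =ᵐ[volume] u) : HasTraceAtZero Ω (restrictTo Ω U) (u 0) :=
  hasTraceAtZero_of_continuous h ((restrictTo_coeFn Ω U).trans (ae_restrict_of_ae hu))

/-- A function that is smooth across the barrier plus a multiple of `oddExp` lies in the domain of
`T₀` as soon as the transmission condition holds. -/
lemma mem_barrierGraph_split_add {κ s : ℝ} (hs : 0 < s) {u v : ℝ → ℂ} {U V W : L2Line}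
    (hu : Continuous u) (hv : Continuous v) (hU : U =ᵐ[volume] u) (hV : V =ᵐ[volume] v)
    (h1 : HasWeakDeriv univ u v) (h2 : HasWeakDeriv univ v W) (a : ℂ)
    (h0 : v 0 - a * s = κ * (2 * a)) :
    (split U + a • oddExp hs, split (-W) + a • ((-s ^ 2 : ℝ) : ℂ) • oddExp hs)
      ∈ barrierGraph κ := by
  have eneg : ∀ Ω, -restrictTo Ω (-W) = restrictTo Ω W := fun Ω => by
    rw [show restrictTo Ω (-W) = -restrictTo Ω W from map_neg (restrictCLM Ω) W, neg_neg]
  -- The boundary values of `oddExp` are `-1` on the left and `1` on the right, and those of its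
  -- derivative are `-s` on both sides. The derivatives therefore match for every `a`, and the jump
  -- condition is `h0`. The products are left unsimplified to match the sum and scalar rules for
  -- traces.
  refine ⟨split V + a • oddExpDeriv hs, u 0 + a * (-1), u 0 + a * 1, v 0 + a * (-(s * 1)),
    v 0 + a * (-s * 1), ⟨?_, ?_⟩, ⟨?_, ?_⟩, ⟨?_, ?_⟩, ⟨?_, ?_⟩, ?_, ?_⟩
  · exact (hasWeakDeriv_restrictTo h1 hU hV).add_Lp ((hasWeakDeriv_expAbs_Iio hs).neg_Lp.smul_Lp a)
  · have := (hasWeakDeriv_restrictTo (Ω := Iio 0) h2 hV (ae_eq_refl _)).add_Lp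
      (((hasWeakDeriv_expAbs_Iio hs).smul_Lp s).neg_Lp.smul_Lp a)
    refine this.congr (ae_eq_refl _)
      (Eq.eventuallyEq (congrArg (fun z : L2 (Iio 0) => (z : ℝ → ℂ)) ?_))
    change -(restrictTo (Iio 0) (-W) + a • ((-s ^ 2 : ℝ) : ℂ) • -expAbs (Iio 0) hs) = _
    rw [neg_add, eneg]
    push_cast
    module
  · exact (hasWeakDeriv_restrictTo h1 hU hV).add_Lp ((hasWeakDeriv_expAbs_Ioi hs).smul_Lp a)
  · have := (hasWeakDeriv_restrictTo (Ω := Ioi 0) h2 hV (ae_eq_refl _)).add_Lp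
      (((hasWeakDeriv_expAbs_Ioi hs).smul_Lp (-s)).smul_Lp a)
    refine this.congr (ae_eq_refl _)
      (Eq.eventuallyEq (congrArg (fun z : L2 (Ioi 0) => (z : ℝ → ℂ)) ?_))
    change -(restrictTo (Ioi 0) (-W) + a • ((-s ^ 2 : ℝ) : ℂ) • expAbs (Ioi 0) hs) = _
    rw [neg_add, eneg]
    push_cast
    module
  · exact (hasTraceAtZero_restrictTo hu hU).add_Lp ((hasTraceAtZero_expAbs_Iio hs).neg_Lp.smul_Lp a)
  · exact (hasTraceAtZero_restrictTo hu hU).add_Lp ((hasTraceAtZero_expAbs_Ioi hs).smul_Lp a)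
  · exact (hasTraceAtZero_restrictTo hv hV).add_Lp
      (((hasTraceAtZero_expAbs_Iio hs).smul_Lp s).neg_Lp.smul_Lp a)
  · exact (hasTraceAtZero_restrictTo hv hV).add_Lp
      (((hasTraceAtZero_expAbs_Ioi hs).smul_Lp (-s)).smul_Lp a)
  · ring
  · linear_combination h0

/-- Two continuous representatives that agree almost everywhere on an open set agree everywhere on
it, and then on its closure by continuity. -/
lemma HasTraceAtZero.unique {Ω : Set ℝ} (hΩ : IsOpen Ω) (h0 : (0 : ℝ) ∈ closure Ω) {u : ℝ → ℂ}
    {a b : ℂ} (ha : HasTraceAtZero Ω u a) (hb : HasTraceAtZero Ω u b) : a = b := by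
  obtain ⟨g, g1, g2, rfl⟩ := ha
  obtain ⟨g', k1, k2, rfl⟩ := hb
  have h : EqOn g g' Ω := Measure.eqOn_open_of_ae_eq (g2.symm.trans k2) hΩ
    (g1.mono subset_closure) (k1.mono subset_closure)
  exact h.of_subset_closure g1 k1 subset_closure Subset.rfl h0

/-- Solutions of `T₀ u = -s² u` are multiples of `oddExp`, and vanish unless `s + 2 κ = 0`. -/
lemma exists_smul_oddExp_of_mem_barrierGraph {κ s : ℝ} (hs : 0 < s) {u : TwoSided}
    (h : (u, ((-s ^ 2 : ℝ) : ℂ) • u) ∈ barrierGraph κ) :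
    ∃ b : ℂ, u = b • oddExp hs ∧ b * (s + 2 * κ) = 0 := by
  obtain ⟨v, um, up, vm, vp, ⟨h1, h2⟩, ⟨h3, h4⟩, ⟨t1, t2⟩, ⟨t3, t4⟩, e1, e2⟩ := h
  simp only at h1 h3 t1 t2
  have hneg : -(((-s ^ 2 : ℝ) : ℂ) • u) = ((s : ℂ) ^ 2) • u := by
    push_cast; module
  simp only [hneg] at h2 h4
  obtain ⟨a, ha, ha'⟩ := HasWeakDeriv.ae_eq_decaying_Iio hs (Lp.memLp _) (Lp.memLp _) h1
    (h2.congr (ae_eq_refl _) (Lp.coeFn_smul ((s : ℂ) ^ 2) u.fst).symm)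
  obtain ⟨b, hb, hb'⟩ := HasWeakDeriv.ae_eq_decaying_Ioi hs (Lp.memLp _) (Lp.memLp _) h3
    (h4.congr (ae_eq_refl _) (Lp.coeFn_smul ((s : ℂ) ^ 2) u.snd).symm)
  have c1 : (0 : ℝ) ∈ closure (Iio (0 : ℝ)) := by simp
  have c2 : (0 : ℝ) ∈ closure (Ioi (0 : ℝ)) := by simp
  have k1 := t1.unique isOpen_Iio c1 (hasTraceAtZero_of_continuous (by fun_prop) ha)
  have k2 := t2.unique isOpen_Ioi c2 (hasTraceAtZero_of_continuous (by fun_prop) hb)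
  have k3 := t3.unique isOpen_Iio c1 (hasTraceAtZero_of_continuous (by fun_prop) ha')
  have k4 := t4.unique isOpen_Ioi c2 (hasTraceAtZero_of_continuous (by fun_prop) hb')
  simp only [mul_zero, Real.exp_zero, Complex.ofReal_one, mul_one] at k1 k2 k3 k4
  have hs' : (s : ℂ) ≠ 0 := by exact_mod_cast hs.ne'
  -- Equality of the one-sided derivatives reads `s a = -s b`; the solution is therefore odd.
  have hab : a = -b := by
    refine mul_left_cancel₀ hs' ?_
    rw [← k3, ← e1, k4]; ring
  refine ⟨b, twoSided_ext ?_ ?_, ?_⟩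
  · have e : (b • oddExp hs).fst = (-b) • expAbs (Iio 0) hs := by
      change b • -expAbs (Iio 0) hs = _
      module
    rw [e]
    filter_upwards [ha, Lp.coeFn_smul (-b) (expAbs (Iio 0) hs), expAbs_ae_Iio hs] with x x1 x2 x3
    rw [x1, x2, Pi.smul_apply, x3, hab, smul_eq_mul]
  · change _ =ᵐ[_] (b • expAbs (Ioi 0) hs : L2 (Ioi 0))
    filter_upwards [hb, Lp.coeFn_smul b (expAbs (Ioi 0) hs), expAbs_ae_Ioi hs] with x x1 x2 x3
    rw [x1, x2, Pi.smul_apply, x3, smul_eq_mul]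
  -- The jump is `2 b`, so the second condition reads `-s b = 2 κ b`.
  · rw [k4, k2, k1, hab] at e2
    linear_combination -e2

lemma isResolventAt_barrierResolvent {κ s : ℝ} (hs : 0 < s) (h : s + 2 * κ ≠ 0) :
    IsResolventAt (barrierLaplacian κ) ((-s ^ 2 : ℝ) : ℂ) (barrierResolvent κ hs) := by
  have h' : (s : ℂ) + 2 * κ ≠ 0 := by exact_mod_cast h
  refine isResolventAt_of_graph (fun f => ?_) (fun u hu => ?_)
  · rw [barrierLaplacian_graph]
    have hf := Lp.memLp (glue f)
    set W : L2Line := ((s : ℂ) ^ 2) • lineResolvent hs (glue f) - glue f with hW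
    have hW' : W =ᵐ[volume] fun x => (s : ℂ) ^ 2 * greenFun s (glue f) x - glue f x := by
      filter_upwards [Lp.coeFn_sub (((s : ℂ) ^ 2) • lineResolvent hs (glue f)) (glue f),
        Lp.coeFn_smul ((s : ℂ) ^ 2) (lineResolvent hs (glue f)),
        lineResolvent_coeFn hs (glue f)] with x h1 h2 h3
      rw [hW, h1, Pi.sub_apply, h2, Pi.smul_apply, h3, smul_eq_mul]
    -- The coefficient `a` must solve `v(0) - a s = 2 κ a` with `v = greenDeriv s (glue f)`. Since
    -- the inner product with `oddExp` is `2 v(0)`, the chosen value is `v(0) / (s + 2 κ)`.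
    have key := mem_barrierGraph_split_add (κ := κ) hs (continuous_greenFun hs hf)
      (continuous_greenDeriv hs hf) (lineResolvent_coeFn hs (glue f))
      (MemLp.coeFn_toLp (memLp_greenDeriv hs hf)) (hasWeakDeriv_greenFun hs hf)
      ((hasWeakDeriv_greenDeriv hs hf).congr (ae_eq_refl _)
        (by rw [Measure.restrict_univ]; exact hW'))
      (rankOneCoeff κ s * inner ℂ (oddExp hs) f) (by
        rw [inner_oddExp_eq, rankOneCoeff]
        push_cast
        field_simp
        ring)
    convert key using 2
    · rw [barrierResolvent_apply, smul_smul]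
    · have : split (-W) = f + ((-s ^ 2 : ℝ) : ℂ) • split (lineResolvent hs (glue f)) := by
        rw [hW, ← splitCLM_apply, ← splitCLM_apply, map_neg, map_sub, map_smul,
          splitCLM_apply (glue f), split_glue]
        push_cast
        module
      rw [this, barrierResolvent_apply]
      module
  · rw [barrierLaplacian_graph] at hu
    obtain ⟨b, hb, hb'⟩ := exists_smul_oddExp_of_mem_barrierGraph hs hu
    rw [hb, (mul_eq_zero.mp hb').resolve_right h', zero_smul]

lemma oddExp_mem_barrierGraph {κ s : ℝ} (hs : 0 < s) (h : s + 2 * κ = 0) :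
    (oddExp hs, ((-s ^ 2 : ℝ) : ℂ) • oddExp hs) ∈ barrierGraph κ := by
  have hz : HasWeakDeriv univ 0 0 := by intro φ _ _ _; simp
  have h0 : ((0 : L2Line) : ℝ → ℂ) =ᵐ[volume] 0 := Lp.coeFn_zero _ _ _
  -- The smooth part is zero and `a = 1`; the transmission condition is then `-s = 2 κ`.
  have key := mem_barrierGraph_split_add (κ := κ) hs (u := 0) (v := 0) (W := 0)
    continuous_const continuous_const h0 h0 hz
    (hz.congr (ae_eq_refl _) (by rw [Measure.restrict_univ]; exact h0)) 1 (by
      have : (s : ℂ) + 2 * κ = 0 := by exact_mod_cast h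
      simp only [Pi.zero_apply]
      linear_combination -this)
  simpa [← splitCLM_apply] using key

lemma oddExp_ne_zero {s : ℝ} (hs : 0 < s) : oddExp hs ≠ 0 := by
  intro h
  have h1 : expAbs (Ioi 0) hs = 0 := congrArg WithLp.snd h
  have h2 := hasTraceAtZero_expAbs_Ioi hs
  rw [h1] at h2
  exact one_ne_zero (h2.unique isOpen_Ioi (by simp) HasTraceAtZero.zero_Lp)

/-! ### Abstract spectral theory -/

lemma not_tendsto_zero_of_norm_eq_one {E : Type*} [NormedAddCommGroup E] {u : ℕ → E} (h : ∀ n, ‖u n‖ = 1) :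
    ¬ Tendsto u atTop (𝓝 0) := by
  intro ht
  have := ht.norm
  simp only [h, norm_zero] at this
  exact one_ne_zero (tendsto_nhds_unique tendsto_const_nhds this)

section Spectral

variable {H : Type*} [NormedAddCommGroup H] [InnerProductSpace ℂ H]

lemma IsResolventAt.injective {T : H →ₗ.[ℂ] H} {z : ℂ} {R : H →L[ℂ] H}
    (h : IsResolventAt T z R) {f : H} (hf : R f = 0) : f = 0 := by
  obtain ⟨hm, e⟩ := h.1 f
  have h0 : (⟨R f, hm⟩ : T.domain) = 0 := Subtype.ext hf
  rw [← e, h0, T.map_zero, hf, smul_zero, sub_zero]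

lemma IsResolventAt.exists_eq {T : H →ₗ.[ℂ] H} {z : ℂ} {R : H →L[ℂ] H}
    (h : IsResolventAt T z R) (f : H) :
    ∃ u : T.domain, (u : H) = R f ∧ T u = f + z • R f := by
  obtain ⟨hm, e⟩ := h.1 f
  exact ⟨⟨R f, hm⟩, rfl, sub_eq_iff_eq_add.mp e⟩

lemma IsResolventAt.eq_apply {T : H →ₗ.[ℂ] H} {z : ℂ} {R : H →L[ℂ] H}
    (h : IsResolventAt T z R) (u : T.domain) : ∃ f : H, (u : H) = R f ∧ T u = f + z • R f :=
  ⟨T u - z • (u : H), (h.2 u).symm, by rw [h.2 u, sub_add_cancel]⟩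

/-- The domain of `T` is the range of `R`. It is dense because a vector orthogonal to it is killed
by the symmetric injective `R`, and `T` is symmetric because `R` is and `μ` is real. It remains to
see that the adjoint has no larger domain. -/
lemma isSelfAdjoint_of_resolvent [CompleteSpace H] {T : H →ₗ.[ℂ] H} {μ : ℝ} {R : H →L[ℂ] H}
    (h : IsResolventAt T μ R) (hR : ∀ f g, inner ℂ (R f) g = inner ℂ f (R g)) :
    IsSelfAdjoint T := by
  have hd : Dense (T.domain : Set H) := by
    rw [Submodule.dense_iff_topologicalClosure_eq_top, Submodule.topologicalClosure_eq_top_iff,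
      Submodule.eq_bot_iff]
    intro x hx
    refine h.injective (ext_inner_left ℂ fun f => ?_)
    rw [← hR, inner_zero_right]
    exact (Submodule.mem_orthogonal _ _).mp hx _ (h.1 f).1
  have hf : T.IsFormalAdjoint T := by
    intro x y
    obtain ⟨f, hf, hf'⟩ := h.eq_apply x
    obtain ⟨g, hg, hg'⟩ := h.eq_apply y
    rw [hf', hg', hf, hg, inner_add_left, inner_add_right, inner_smul_left, inner_smul_right, hR,
      Complex.conj_ofReal, hR f g]
  rw [LinearPMap.isSelfAdjoint_def]
  have hle : T ≤ LinearPMap.adjoint T := hf.le_adjoint hd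
  refine (LinearPMap.eq_of_le_of_domain_eq hle (le_antisymm hle.1 fun v hv => ?_)).symm
  -- Any `f` is `(T - μ) u` with `u = R f`; pairing with it shows that every `v` in the domain of
  -- the adjoint lies in the range of `R`.
  have e : R (LinearPMap.adjoint T ⟨v, hv⟩ - (μ : ℂ) • v) = v := by
    refine ext_inner_right ℂ fun f => ?_
    obtain ⟨u, hu, hu'⟩ := h.exists_eq f
    have h1 := LinearPMap.adjoint_isFormalAdjoint hd ⟨v, hv⟩ u
    rw [hu, hu', inner_add_right, inner_smul_right] at h1
    rw [hR, inner_sub_left, h1, inner_smul_left, Complex.conj_ofReal]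
    ring
  rw [← e]
  exact (h.1 _).1

/-- From `T - z = (1 - (z - μ) R)(T - μ)`, inverting `T - z` amounts to inverting `(z - μ)⁻¹ - R`.
This is possible because `R` is bounded and self-adjoint, with real spectrum, whereas `(z - μ)⁻¹` is
not real. -/
lemma exists_isResolventAt_of_im_ne_zero [CompleteSpace H] {T : H →ₗ.[ℂ] H} {μ : ℝ}
    {R : H →L[ℂ] H} (h : IsResolventAt T μ R)
    (hR : ∀ f g, inner ℂ (R f) g = inner ℂ f (R g)) {z : ℂ} (hz : z.im ≠ 0) :
    ∃ S : H →L[ℂ] H, IsResolventAt T z S := by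
  have hsa : IsSelfAdjoint R :=
    ContinuousLinearMap.isSelfAdjoint_iff_isSymmetric.mpr fun f g => hR f g
  have hzμ : z - μ ≠ 0 := fun h0 => hz (by simpa using congrArg Complex.im h0)
  have hw : (z - μ)⁻¹ ∉ spectrum ℂ R := by
    intro hw
    have him := hsa.im_eq_zero_of_mem_spectrum hw
    rw [Complex.inv_im, div_eq_zero_iff, neg_eq_zero] at him
    rcases him with him | him
    · exact hz (by simpa using him)
    · exact hzμ (Complex.normSq_eq_zero.mp him)
  obtain ⟨S, hS⟩ := spectrum.notMem_iff.mp hw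
  have hS1 : ∀ f, (z - μ)⁻¹ • (S⁻¹.val f) - R (S⁻¹.val f) = f := fun f => by
    have := congrArg (fun A : H →L[ℂ] H => A f) S.mul_inv
    rw [hS] at this
    simpa [Algebra.algebraMap_eq_smul_one] using this
  have hS2 : ∀ f, S⁻¹.val ((z - μ)⁻¹ • f - R f) = f := fun f => by
    have := congrArg (fun A : H →L[ℂ] H => A f) S.inv_mul
    rw [hS] at this
    simpa [Algebra.algebraMap_eq_smul_one] using this
  refine ⟨(z - μ)⁻¹ • (R ∘L S⁻¹.val), fun f => ?_, fun u => ?_⟩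
  · obtain ⟨u, hu, hu'⟩ := h.exists_eq ((z - μ)⁻¹ • S⁻¹.val f)
    have e : ((z - μ)⁻¹ • (R ∘L S⁻¹.val)) f = u := by rw [hu, map_smul]; rfl
    have hm : ((z - μ)⁻¹ • (R ∘L S⁻¹.val)) f ∈ T.domain := e ▸ u.2
    refine ⟨hm, ?_⟩
    have e' : (⟨_, hm⟩ : T.domain) = u := Subtype.ext e
    rw [e', e, hu', ← hu, add_sub_assoc, ← sub_smul, hu, map_smul, smul_smul]
    have : ((μ : ℂ) - z) * (z - μ)⁻¹ = -1 := by
      rw [← neg_sub z, neg_mul, mul_inv_cancel₀ hzμ]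
    rw [this, neg_one_smul, ← sub_eq_add_neg, hS1]
  · obtain ⟨g, hg, hg'⟩ := h.eq_apply u
    have e : T u - z • (u : H) = (z - μ) • ((z - μ)⁻¹ • g - R g) := by
      rw [hg', hg, smul_sub, smul_smul, mul_inv_cancel₀ hzμ, one_smul]
      module
    rw [e, map_smul]
    change (z - μ) • (z - μ)⁻¹ • R (S⁻¹.val _) = _
    rw [hS2, smul_smul, mul_inv_cancel₀ hzμ, one_smul, hg]

/-! ### Eigenvalues and essential spectrum in terms of resolvents. -/

lemma mem_eigenspace_iff {T : H →ₗ.[ℂ] H} {z : ℂ} {u : H} :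
    u ∈ eigenspace T z ↔ (u, z • u) ∈ T.graph := by
  rw [LinearPMap.mem_graph_iff]
  constructor
  · rintro ⟨h, e⟩
    exact ⟨⟨u, h⟩, rfl, e⟩
  · rintro ⟨⟨y, hy⟩, h1, h2⟩
    obtain rfl : y = u := h1
    exact ⟨hy, h2⟩

lemma IsEigenvalue.mem_opSpectrum {T : H →ₗ.[ℂ] H} {z : ℂ} (h : IsEigenvalue T z) :
    z ∈ opSpectrum T := by
  rintro ⟨R, hR⟩
  obtain ⟨u, ⟨hu, e⟩, hne⟩ := h
  have := hR.2 ⟨u, hu⟩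
  rw [e, sub_self, map_zero] at this
  exact hne this.symm

lemma essentialSpectrum_subset_opSpectrum (T : H →ₗ.[ℂ] H) :
    essentialSpectrum T ⊆ opSpectrum T := by
  rintro z ⟨u, h1, -, h3⟩ ⟨R, hR⟩
  refine not_tendsto_zero_of_norm_eq_one h1 ?_
  have := (R.continuous.tendsto 0).comp h3
  rw [map_zero] at this
  exact this.congr fun n => hR.2 (u n)

/-- A rank-one perturbation of the resolvent does not create essential spectrum. -/
lemma notMem_essentialSpectrum_of_rank_one {T₁ T₂ : H →ₗ.[ℂ] H} {z w : ℂ} {R₁ R₂ S : H →L[ℂ] H}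
    (h₁ : IsResolventAt T₁ w R₁) (h₂ : IsResolventAt T₂ w R₂) (hS : IsResolventAt T₂ z S)
    {c : ℂ} {L : H} (hL : ∀ f, R₁ f = R₂ f + c • inner ℂ L f • L) :
    z ∉ essentialSpectrum T₁ := by
  rintro ⟨u, hu1, hu2, hu3⟩
  set g : ℕ → H := fun n => T₁ (u n) - z • (u n : H) with hg
  -- This is `-(T₂ - z) R₂ u n`: the sequence `R₂ u n` will be shown to tend to zero by applying the
  -- bounded inverse `S` to it.
  set v : ℕ → H := fun n => (z - w) • R₂ (u n) - (u n : H) with hv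
  -- The resolvent `R₁` gives `u n = R₁ (g n) + (z - w) R₁ (u n)`. Replacing the last `R₁` by `R₂`
  -- costs only the rank-one term, which weak convergence of `u n` sends to zero.
  have hvg : ∀ n, v n = -(R₁ (g n)) - (z - w) • c • inner ℂ L (u n : H) • L := by
    intro n
    have e := h₁.2 (u n)
    have e2 : T₁ (u n) - w • (u n : H) = g n + (z - w) • (u n : H) := by rw [hg]; module
    rw [e2, map_add, map_smul, hL (u n)] at e
    rw [hv]
    simp only
    nth_rewrite 2 [← e]
    module
  have hv0 : Tendsto v atTop (𝓝 0) := by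
    have t1 := (R₁.continuous.tendsto 0).comp hu3
    have t2 := ((((hu2 L).smul_const L).const_smul c).const_smul (z - w))
    rw [map_zero] at t1
    have t3 := t1.neg.sub t2
    simp only [zero_smul, smul_zero, neg_zero, sub_zero] at t3
    exact t3.congr fun n => (hvg n).symm
  have hw0 : Tendsto (fun n => R₂ (u n)) atTop (𝓝 0) := by
    have t1 := ((S.continuous.tendsto 0).comp hv0).neg
    rw [map_zero, neg_zero] at t1
    refine t1.congr fun n => ?_
    obtain ⟨y, hy, hy'⟩ := h₂.exists_eq (u n : H)
    have e := hS.2 y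
    rw [hy', hy] at e
    rw [← e, Function.comp_apply, ← map_neg, hv]
    congr 1
    module
  -- Both terms of `u n = (z - w) R₂ (u n) - v n` tend to zero, against the normalisation.
  refine not_tendsto_zero_of_norm_eq_one hu1 ?_
  have t := (hw0.const_smul (z - w)).sub hv0
  rw [smul_zero, sub_zero] at t
  refine t.congr fun n => ?_
  rw [hv]
  module

end Spectral

/-! ### Singular sequences -/

lemma norm_sq_toLp {μ : Measure ℝ} {f : ℝ → ℂ} (hf : MemLp f 2 μ) :
    ‖hf.toLp f‖ ^ 2 = ∫ x, ‖f x‖ ^ 2 ∂μ := by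
  have h0 : 0 ≤ ∫ x, ‖f x‖ ^ 2 ∂μ := integral_nonneg fun x => sq_nonneg _
  rw [Lp.norm_toLp, hf.eLpNorm_eq_integral_rpow_norm (by norm_num) (by norm_num),
    ENNReal.toReal_ofReal (by positivity)]
  simp only [ENNReal.toReal_ofNat, Real.rpow_ofNat]
  rw [← one_div, ← Real.sqrt_eq_rpow, Real.sq_sqrt h0]

/-- Functions that are twice continuously differentiable, vanish to first order at the barrier and
are put on the right half-line belong to the domain of `T₀`. -/
lemma mem_barrierGraph_of_hasDerivAt (κ : ℝ) {u v w : ℝ → ℂ}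
    (h1 : ∀ x, HasDerivAt u (v x) x) (h2 : ∀ x, HasDerivAt v (w x) x) (hw : Continuous w)
    (u0 : u 0 = 0) (v0 : v 0 = 0) {U V W : L2 (Ioi 0)} (hU : U =ᵐ[volume.restrict (Ioi 0)] u)
    (hV : V =ᵐ[volume.restrict (Ioi 0)] v) (hW : W =ᵐ[volume.restrict (Ioi 0)] w) :
    ((WithLp.toLp 2 (0, U) : TwoSided), (WithLp.toLp 2 (0, -W) : TwoSided)) ∈ barrierGraph κ := by
  have hv : Continuous v := continuous_iff_continuousAt.mpr fun x => (h2 x).continuousAt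
  have hu : Continuous u := continuous_iff_continuousAt.mpr fun x => (h1 x).continuousAt
  have e1 : (-(WithLp.toLp 2 (0, -W) : TwoSided)).fst = 0 := neg_zero
  have e2 : (-(WithLp.toLp 2 (0, -W) : TwoSided)).snd = W := neg_neg W
  refine ⟨WithLp.toLp 2 (0, V), 0, u 0, 0, v 0, ⟨.zero_Lp, ?_⟩,
    ⟨(hasWeakDeriv_of_hasDerivAt h1 hv).congr hU hV, ?_⟩,
    ⟨.zero_Lp, hasTraceAtZero_of_continuous hu hU⟩,
    ⟨.zero_Lp, hasTraceAtZero_of_continuous hv hV⟩, v0, by simp [u0, v0]⟩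
  · simp only [e1]
    exact .zero_Lp
  · simp only [e2]
    exact (hasWeakDeriv_of_hasDerivAt h2 hw).congr hV hW

/-- The function `x ↦ m^{-1/2} χ(x/m) e^{ikx}`. -/
def wavePacket (k m : ℝ) (χ : ℝ → ℝ) (x : ℝ) : ℂ :=
  (((√m)⁻¹ * χ (x / m) : ℝ) : ℂ) * Complex.exp (Complex.I * k * x)

/-- Continuous profiles with compact support in `(1, ∞)`. -/
structure IsProfile (χ : ℝ → ℝ) : Prop where
  continuous : Continuous χ
  compact : HasCompactSupport χ
  supp : tsupport χ ⊆ Ioi 1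

lemma IsProfile.eq_zero {χ : ℝ → ℝ} (h : IsProfile χ) {x : ℝ} (hx : x ≤ 1) : χ x = 0 :=
  image_eq_zero_of_notMem_tsupport fun h' => not_lt.mpr hx (h.supp h')

lemma norm_wavePacket (k m : ℝ) (χ : ℝ → ℝ) (x : ℝ) :
    ‖wavePacket k m χ x‖ = |(√m)⁻¹ * χ (x / m)| := by
  rw [wavePacket, norm_mul, Complex.norm_real, Real.norm_eq_abs, Complex.norm_exp]
  simp

lemma IsProfile.wavePacket_eq_zero {χ : ℝ → ℝ} (h : IsProfile χ) {k m x : ℝ} (hm : 0 < m)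
    (hx : x ≤ m) : wavePacket k m χ x = 0 := by
  rw [wavePacket, h.eq_zero ((div_le_one hm).mpr hx)]
  simp

lemma IsProfile.continuous_wavePacket {χ : ℝ → ℝ} (h : IsProfile χ) (k m : ℝ) :
    Continuous (wavePacket k m χ) := by
  have := h.continuous
  unfold wavePacket
  fun_prop

lemma IsProfile.memLp_wavePacket {χ : ℝ → ℝ} (h : IsProfile χ) (k : ℝ) {m : ℝ} (hm : 0 < m) :
    MemLp (wavePacket k m χ) 2 volume := by
  refine (h.continuous_wavePacket k m).memLp_of_hasCompactSupport ?_
  have h1 : HasCompactSupport fun x => χ (x / m) := by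
    simpa [div_eq_mul_inv, Function.comp_def] using
      h.compact.comp_homeomorph (Homeomorph.mulRight₀ m⁻¹ (inv_ne_zero hm.ne'))
  have h2 : HasCompactSupport fun x => (((√m)⁻¹ * χ (x / m) : ℝ) : ℂ) :=
    (h1.mul_left (f := fun _ => (√m)⁻¹)).comp_left (g := fun t : ℝ => (t : ℂ)) (by simp)
  exact h2.mul_right

/-- The wave packet as an element of `L²(ℝ₊)`. -/
def packet {χ : ℝ → ℝ} (h : IsProfile χ) (k : ℝ) {m : ℝ} (hm : 0 < m) : L2 (Ioi 0) :=
  MemLp.toLp (wavePacket k m χ) ((h.memLp_wavePacket k hm).restrict _)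

lemma packet_coeFn {χ : ℝ → ℝ} (h : IsProfile χ) (k : ℝ) {m : ℝ} (hm : 0 < m) :
    packet h k hm =ᵐ[volume.restrict (Ioi 0)] wavePacket k m χ :=
  MemLp.coeFn_toLp ((h.memLp_wavePacket k hm).restrict _)

/-- The prefactor `m^{-1/2}` offsets the dilation, so packets of all widths have the same norm. -/
lemma norm_packet_sq {χ : ℝ → ℝ} (h : IsProfile χ) (k : ℝ) {m : ℝ} (hm : 0 < m) :
    ‖packet h k hm‖ ^ 2 = ∫ x, χ x ^ 2 := by
  rw [packet, norm_sq_toLp, setIntegral_eq_integral_of_forall_compl_eq_zero]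
  · have e : ∀ x, ‖wavePacket k m χ x‖ ^ 2 = m⁻¹ * (fun y => χ y ^ 2) (x / m) := by
      intro x
      rw [norm_wavePacket, sq_abs, mul_pow, inv_pow, Real.sq_sqrt hm.le]
    simp_rw [e]
    rw [integral_const_mul, Measure.integral_comp_div (fun y => χ y ^ 2), abs_of_pos hm, smul_eq_mul, ← mul_assoc,
      inv_mul_cancel₀ hm.ne', one_mul]
  · intro x hx
    rw [h.wavePacket_eq_zero hm ((not_lt.mp hx).trans hm.le)]
    simp

lemma hasDerivAt_wavePacket {χ : ℝ → ℝ} {χ' : ℝ → ℝ} (h : ∀ x, HasDerivAt χ (χ' x) x) (k m x : ℝ) :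
    HasDerivAt (wavePacket k m χ)
      (Complex.I * k * wavePacket k m χ x + (m⁻¹ : ℂ) * wavePacket k m χ' x) x := by
  have h1 : HasDerivAt (fun x => (√m)⁻¹ * χ (x / m)) ((√m)⁻¹ * (χ' (x / m) * m⁻¹)) x := by
    refine HasDerivAt.const_mul _ ?_
    have := (h (x / m)).comp x ((hasDerivAt_id' x).div_const m)
    simpa [one_div, Function.comp_def] using this
  have h2 : HasDerivAt (fun x : ℝ => Complex.exp (Complex.I * k * x))
      (Complex.exp (Complex.I * k * x) * (Complex.I * k)) x := by
    refine HasDerivAt.cexp ?_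
    simpa using (hasDerivAt_id' x).ofReal_comp.const_mul (Complex.I * k)
  have h3 : HasDerivAt (wavePacket k m χ) _ x := h1.ofReal_comp.mul h2
  refine h3.congr_deriv ?_
  simp only [wavePacket]
  push_cast
  ring

/-- The `n`-th packet vanishes on `(0, n + 1]`, so it only sees the tail of `v`, whose norm tends to
zero by dominated convergence. No oscillation is used, so `k = 0` needs no separate treatment. -/
lemma tendsto_inner_packet {χ : ℝ → ℝ} (h : IsProfile χ) (k : ℝ) (v : L2 (Ioi 0)) :
    Tendsto (fun n : ℕ => inner ℂ v (packet h k (Nat.cast_add_one_pos (α := ℝ) n)))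
      atTop (𝓝 0) := by
  have hv2 : Integrable (fun x => ‖v x‖ ^ 2) (volume.restrict (Ioi 0)) :=
    (memLp_two_iff_integrable_sq_norm (Lp.memLp v).1).mp (Lp.memLp v)
  have hm : ∀ n : ℕ, MemLp ((Ioi ((n : ℝ) + 1)).indicator v) 2 (volume.restrict (Ioi 0)) :=
    fun n => (Lp.memLp v).indicator measurableSet_Ioi
  have hlim : Tendsto (fun n : ℕ => ‖(hm n).toLp _‖ ^ 2) atTop (𝓝 0) := by
    have key := tendsto_integral_of_dominated_convergence (μ := volume.restrict (Ioi (0 : ℝ)))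
      (F := fun (n : ℕ) x => ‖(Ioi ((n : ℝ) + 1)).indicator v x‖ ^ 2) (f := fun _ => (0 : ℝ))
      (fun x => ‖v x‖ ^ 2) (fun n => ((hm n).1.norm.pow 2)) hv2
      (fun n => Eventually.of_forall fun x => by
        rw [Real.norm_eq_abs, abs_of_nonneg (by positivity)]
        gcongr
        exact norm_indicator_le_norm_self _ _)
      (Eventually.of_forall fun x => by
        refine tendsto_const_nhds.congr' ?_
        obtain ⟨N, hN⟩ := exists_nat_gt x
        filter_upwards [eventually_ge_atTop N] with n hn
        have : (N : ℝ) ≤ n := by exact_mod_cast hn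
        rw [indicator_of_notMem (by simp only [mem_Ioi, not_lt]; linarith)]
        simp)
    rw [integral_zero] at key
    exact key.congr fun n => (norm_sq_toLp (hm n)).symm
  have hlim' : Tendsto (fun n : ℕ => ‖(hm n).toLp _‖ * √(∫ x, χ x ^ 2)) atTop (𝓝 0) := by
    have := (hlim.sqrt).mul_const √(∫ x, χ x ^ 2)
    simpa [Real.sqrt_sq (norm_nonneg _)] using this
  refine squeeze_zero_norm (fun n => ?_) hlim'
  have hpos := Nat.cast_add_one_pos (α := ℝ) n
  have e : inner ℂ v (packet h k hpos) = inner ℂ ((hm n).toLp _) (packet h k hpos) := by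
    rw [L2.inner_def, L2.inner_def]
    refine integral_congr_ae ?_
    filter_upwards [MemLp.coeFn_toLp (hm n), packet_coeFn h k hpos] with x h1 h2
    rw [h1, h2]
    by_cases hx : (n : ℝ) + 1 < x
    · rw [indicator_of_mem (mem_Ioi.mpr hx)]
    · rw [h.wavePacket_eq_zero hpos (not_lt.mp hx), inner_zero_right, inner_zero_right]
  rw [e, ← norm_packet_sq h k hpos, Real.sqrt_sq (norm_nonneg _)]
  exact norm_inner_le_norm _ _

lemma exists_profile : ∃ ψ : ℝ → ℝ, ContDiff ℝ ∞ ψ ∧ IsProfile ψ ∧ ∫ x, ψ x ^ 2 = 1 := by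
  obtain ⟨η, η1, η2, η3, η4, η5⟩ :=
    exists_contDiff_tsupport_subset (n := ⊤) (Ioi_mem_nhds (one_lt_two (α := ℝ)))
  have hpos : 0 < ∫ x, η x ^ 2 :=
    (η3.continuous.pow 2).integral_pos_of_hasCompactSupport_nonneg_nonzero (x := 2)
      (by simpa [sq, Pi.mul_def] using η2.mul_left (f := η)) (fun x => sq_nonneg (η x)) (by simp [η5])
  refine ⟨fun x => (√(∫ x, η x ^ 2))⁻¹ * η x, contDiff_const.mul η3,
    ⟨continuous_const.mul η3.continuous, η2.mul_left, tsupport_mul_subset_right.trans η1⟩, ?_⟩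
  simp_rw [mul_pow, inv_pow, Real.sq_sqrt hpos.le]
  rw [integral_const_mul, inv_mul_cancel₀ hpos.ne']

lemma IsProfile.deriv {χ : ℝ → ℝ} (h : IsProfile χ) (h' : ContDiff ℝ ∞ χ) :
    IsProfile (deriv χ) where
  continuous := h'.continuous_deriv (by simp)
  compact := h.compact.deriv
  supp := (closure_mono support_deriv_subset).trans
    ((closure_closure (s := Function.support χ)).subset.trans h.supp)

/-- Applying `-d²/dx² - k²` to a packet leaves only terms where a derivative falls on the slowly
varying profile. These are packets with profiles `ψ'` and `ψ''` and factors of order `1/m` and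
`1/m²`, while the norms of the packets stay fixed. The packets vanish near the barrier, so the
transmission conditions hold whatever `κ` is. -/
lemma sq_mem_essentialSpectrum (κ k : ℝ) :
    ((k ^ 2 : ℝ) : ℂ) ∈ essentialSpectrum (barrierLaplacian κ) := by
  obtain ⟨ψ, ψ0, ψ1, ψ2⟩ := exists_profile
  have ψ0' : ContDiff ℝ ∞ (deriv ψ) := (contDiff_infty_iff_deriv.mp ψ0).2
  have p1 := ψ1.deriv ψ0
  have p2 := p1.deriv ψ0'
  have d0 : ∀ x, HasDerivAt ψ (deriv ψ x) x := fun x =>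
    (ψ0.differentiable (by simp) x).hasDerivAt
  have d1 : ∀ x, HasDerivAt (deriv ψ) (deriv (deriv ψ) x) x := fun x =>
    (ψ0'.differentiable (by simp) x).hasDerivAt
  have hpos := fun n : ℕ => Nat.cast_add_one_pos (α := ℝ) n
  set m : ℕ → ℝ := fun n => (n : ℝ) + 1 with hmdef
  set a : ℕ → L2 (Ioi 0) := fun n => packet ψ1 k (hpos n) with ha
  set b : ℕ → L2 (Ioi 0) := fun n => packet p1 k (hpos n) with hb
  set c : ℕ → L2 (Ioi 0) := fun n => packet p2 k (hpos n) with hc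
  have hgraph : ∀ n, ((WithLp.toLp 2 (0, a n) : TwoSided),
      (WithLp.toLp 2 (0, -(-((k : ℂ) ^ 2) • a n + (2 * Complex.I * k * (m n : ℂ)⁻¹) • b n
        + ((m n : ℂ)⁻¹ ^ 2) • c n)) : TwoSided)) ∈ barrierGraph κ := by
    intro n
    have A : a n =ᵐ[volume.restrict (Ioi 0)] wavePacket k (m n) ψ :=
      packet_coeFn ψ1 k (hpos n)
    have B : b n =ᵐ[volume.restrict (Ioi 0)] wavePacket k (m n) (deriv ψ) :=
      packet_coeFn p1 k (hpos n)
    have C : c n =ᵐ[volume.restrict (Ioi 0)] wavePacket k (m n) (deriv (deriv ψ)) :=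
      packet_coeFn p2 k (hpos n)
    refine mem_barrierGraph_of_hasDerivAt κ (hasDerivAt_wavePacket d0 k (m n))
      (w := fun x => Complex.I * k * (Complex.I * k * wavePacket k (m n) ψ x +
        (m n : ℂ)⁻¹ * wavePacket k (m n) (deriv ψ) x) + (m n : ℂ)⁻¹ * (Complex.I * k *
        wavePacket k (m n) (deriv ψ) x + (m n : ℂ)⁻¹ * wavePacket k (m n) (deriv (deriv ψ)) x))
      (V := (Complex.I * k) • a n + ((m n : ℂ)⁻¹) • b n)
      (fun x => ((hasDerivAt_wavePacket d0 k (m n) x).const_mul _).add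
        ((hasDerivAt_wavePacket d1 k (m n) x).const_mul _)) ?_ ?_ ?_ A ?_ ?_
    · have := ψ1.continuous_wavePacket k (m n)
      have := p1.continuous_wavePacket k (m n)
      have := p2.continuous_wavePacket k (m n)
      fun_prop
    · exact ψ1.wavePacket_eq_zero (hpos n) (hpos n).le
    · rw [ψ1.wavePacket_eq_zero (hpos n) (hpos n).le, p1.wavePacket_eq_zero (hpos n) (hpos n).le]
      simp
    · filter_upwards [A, B, Lp.coeFn_add ((Complex.I * k) • a n) (((m n : ℂ)⁻¹) • b n),
        Lp.coeFn_smul (Complex.I * k) (a n), Lp.coeFn_smul ((m n : ℂ)⁻¹) (b n)] with x h1 h2 h3 h4 h5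
      simp only [h3, Pi.add_apply, h4, h5, Pi.smul_apply, h1, h2, smul_eq_mul]
    · filter_upwards [A, B, C, Lp.coeFn_add (-((k : ℂ) ^ 2) • a n +
          (2 * Complex.I * k * (m n : ℂ)⁻¹) • b n) (((m n : ℂ)⁻¹ ^ 2) • c n),
        Lp.coeFn_add (-((k : ℂ) ^ 2) • a n) ((2 * Complex.I * k * (m n : ℂ)⁻¹) • b n),
        Lp.coeFn_smul (-((k : ℂ) ^ 2)) (a n),
        Lp.coeFn_smul (2 * Complex.I * k * (m n : ℂ)⁻¹) (b n),
        Lp.coeFn_smul ((m n : ℂ)⁻¹ ^ 2) (c n)] with x h1 h2 h3 h4 h5 h6 h7 h8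
      simp only [h4, h5, Pi.add_apply, h6, h7, h8, Pi.smul_apply, h1, h2, h3,
        smul_eq_mul]
      linear_combination (-(k : ℂ) ^ 2 * wavePacket k (m n) ψ x) * Complex.I_sq
  have hdom : ∀ n, ∃ u : (barrierLaplacian κ).domain, (u : TwoSided) = WithLp.toLp 2 (0, a n) ∧
      barrierLaplacian κ u = WithLp.toLp 2 (0, -(-((k : ℂ) ^ 2) • a n +
        (2 * Complex.I * k * (m n : ℂ)⁻¹) • b n + ((m n : ℂ)⁻¹ ^ 2) • c n)) := fun n => by
    have := hgraph n
    rw [← barrierLaplacian_graph] at this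
    exact (LinearPMap.mem_graph_iff _).mp this
  choose u hu hu' using hdom
  refine ⟨u, fun n => ?_, fun v => ?_, ?_⟩
  · rw [hu, ← sq_eq_sq₀ (norm_nonneg _) zero_le_one, WithLp.prod_norm_sq_eq_of_L2]
    change ‖(0 : L2 (Iio 0))‖ ^ 2 + ‖a n‖ ^ 2 = _
    rw [ha, norm_packet_sq, ψ2]
    simp
  · refine (tendsto_inner_packet ψ1 k v.snd).congr fun n => ?_
    rw [hu, WithLp.prod_inner_apply]
    change _ = inner ℂ v.fst (0 : L2 (Iio 0)) + inner ℂ v.snd (a n)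
    rw [inner_zero_right, zero_add]
  · have e : ∀ n, barrierLaplacian κ (u n) - ((k ^ 2 : ℝ) : ℂ) • (u n : TwoSided) =
        WithLp.toLp 2 (0, -((2 * Complex.I * k * (m n : ℂ)⁻¹) • b n + ((m n : ℂ)⁻¹ ^ 2) • c n)) := by
      intro n
      rw [hu, hu']
      refine WithLp.ofLp_injective 2 (Prod.ext ?_ ?_)
      · change (0 : L2 (Iio 0)) - _ • (0 : L2 (Iio 0)) = 0
        simp
      · change -(_ + _ + _) - ((k ^ 2 : ℝ) : ℂ) • a n = -(_ + _)
        push_cast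
        module
    have hm0 : Tendsto (fun n => (m n : ℂ)⁻¹) atTop (𝓝 0) := by
      have h1 : Tendsto (fun n => (m n)⁻¹) atTop (𝓝 0) :=
        tendsto_inv_atTop_zero.comp (tendsto_natCast_atTop_atTop.atTop_add tendsto_const_nhds)
      have h2 := (Complex.continuous_ofReal.tendsto 0).comp h1
      simpa [Function.comp_def] using h2
    have hbdd : ∀ (χ : ℝ → ℝ) (h : IsProfile χ) (t : ℕ → ℂ), Tendsto t atTop (𝓝 0) →
        Tendsto (fun n => t n • packet h k (hpos n)) atTop (𝓝 0) := by
      intro χ h t ht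
      refine squeeze_zero_norm (a := fun n => ‖t n‖ * √(∫ x, χ x ^ 2)) (fun n => ?_) ?_
      · rw [norm_smul, ← norm_packet_sq h k (hpos n), Real.sqrt_sq (norm_nonneg _)]
      · simpa using ht.norm.mul_const √(∫ x, χ x ^ 2)
    have l1 := hbdd _ p1 (fun n => 2 * Complex.I * k * (m n : ℂ)⁻¹) (by
      simpa using hm0.const_mul (2 * Complex.I * (k : ℂ)))
    have l2 := hbdd _ p2 (fun n => (m n : ℂ)⁻¹ ^ 2) (by simpa using hm0.pow 2)
    have l3 := (l1.add l2).neg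
    rw [add_zero, neg_zero] at l3
    have l4 := ((WithLp.prod_continuous_toLp 2 (L2 (Iio 0)) (L2 (Ioi 0))).tendsto (0, 0)).comp
      ((tendsto_const_nhds (x := (0 : L2 (Iio 0)))).prodMk_nhds l3)
    refine (l4.congr fun n => (e n).symm)

/-! ### The integral kernel of the resolvent -/

lemma memLp_exp_abs_sub {s : ℝ} (hs : 0 < s) (x : ℝ) :
    MemLp (fun y : ℝ => (Real.exp (-s * |x - y|) : ℂ)) 2 volume :=
  MemLp.comp_sub_left' (memLp_exp_abs hs) x

lemma expKernel_add_neg (s : ℝ) {t : ℝ} (ht : t ≠ 0) :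
    expKernel s t + expKernel s (-t) = (Real.exp (-s * |t|) : ℂ) := by
  rcases lt_or_gt_of_ne ht with h | h
  · rw [expKernel, expKernel, indicator_of_notMem (by simpa using h.le),
      indicator_of_mem (by simpa using h), zero_add, abs_of_neg h]
  · rw [expKernel, expKernel, indicator_of_mem (by simpa using h),
      indicator_of_notMem (by simpa using h.le), add_zero, abs_of_pos h]

/-- The two one-sided kernels add up to `e^{-s|x-y|}` except at `y = x`, where both vanish; that
point is a null set. -/
lemma greenFun_glue {s : ℝ} (hs : 0 < s) (f : TwoSided) (x : ℝ) :
    greenFun s (glue f) x = (1 / (2 * s) : ℂ) *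
      ((∫ y in Iio (0 : ℝ), (Real.exp (-s * |x - y|) : ℂ) * f.fst y) +
        ∫ y in Ioi (0 : ℝ), (Real.exp (-s * |x - y|) : ℂ) * f.snd y) := by
  have hk := isConvKernel_expKernel hs
  have hF := Lp.memLp (glue f)
  have hi : Integrable (fun y => (Real.exp (-s * |x - y|) : ℂ) * glue f y) volume :=
    (memLp_exp_abs_sub hs x).integrable_mul hF
  have e1 : ∫ y in Iio (0 : ℝ), (Real.exp (-s * |x - y|) : ℂ) * f.fst y =
      ∫ y in Iio (0 : ℝ), (Real.exp (-s * |x - y|) : ℂ) * glue f y :=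
    integral_congr_ae (by filter_upwards [glue_ae_Iio f] with y hy; rw [hy])
  have e2 : ∫ y in Ioi (0 : ℝ), (Real.exp (-s * |x - y|) : ℂ) * f.snd y =
      ∫ y in Ioi (0 : ℝ), (Real.exp (-s * |x - y|) : ℂ) * glue f y :=
    integral_congr_ae (by filter_upwards [glue_ae_Ioi f] with y hy; rw [hy])
  rw [greenFun, convFun, convFun, ← integral_add (integrable_kernel_mul hk.memLp hF x)
    (integrable_kernel_mul hk.comp_neg.memLp hF x), e1, e2, ← integral_Iic_eq_integral_Iio,
    intervalIntegral.integral_Iic_add_Ioi hi.integrableOn hi.integrableOn]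
  congr 1
  refine integral_congr_ae ?_
  filter_upwards [compl_mem_ae_iff.mpr (measure_singleton x)] with y hy
  rw [← add_mul, expKernel_add_neg s (sub_ne_zero.mpr fun h => hy h.symm)]

lemma integral_barrierKernel (κ : ℝ) {s : ℝ} (hs : 0 < s) (τ x : ℝ) {Ω : Set ℝ} (u : L2 Ω) :
    ∫ y in Ω, (barrierKernel κ s τ x y : ℂ) * u y =
      (1 / (2 * s) : ℂ) * (∫ y in Ω, (Real.exp (-s * |x - y|) : ℂ) * u y) +
        τ * rankOneCoeff κ s * (Real.exp (-s * |x|) : ℂ) * inner ℂ (expAbs Ω hs) u := by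
  have hi1 : Integrable (fun y => (Real.exp (-s * |x - y|) : ℂ) * u y) (volume.restrict Ω) :=
    ((memLp_exp_abs_sub hs x).restrict Ω).integrable_mul (Lp.memLp u)
  have hi2 : Integrable (fun y => (Real.exp (-s * |y|) : ℂ) * u y) (volume.restrict Ω) :=
    ((memLp_exp_abs hs).restrict Ω).integrable_mul (Lp.memLp u)
  have e : inner ℂ (expAbs Ω hs) u = ∫ y in Ω, (Real.exp (-s * |y|) : ℂ) * u y := by
    rw [L2.inner_def]
    refine integral_congr_ae ?_
    filter_upwards [expAbs_coeFn Ω hs] with y hy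
    rw [hy, RCLike.inner_apply, Complex.conj_ofReal, mul_comm]
  rw [e, ← integral_const_mul, ← integral_const_mul,
    ← integral_add (hi1.const_mul _) (hi2.const_mul _)]
  congr 1
  funext y
  rw [barrierKernel, rankOneCoeff, mul_add (-s) |x| |y|, Real.exp_add]
  push_cast
  ring

lemma barrierResolvent_fst_ae (κ : ℝ) {s : ℝ} (hs : 0 < s) (f : TwoSided) :
    ∀ᵐ x ∂(volume.restrict (Iio (0 : ℝ))), (barrierResolvent κ hs f).fst x =
      (∫ y in Iio (0 : ℝ), (barrierKernel κ s 1 x y : ℂ) * f.fst y) +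
        ∫ y in Ioi (0 : ℝ), (barrierKernel κ s (-1) x y : ℂ) * f.snd y := by
  have e : (barrierResolvent κ hs f).fst = restrictTo (Iio 0) (lineResolvent hs (glue f)) +
      (-(rankOneCoeff κ s * inner ℂ (oddExp hs) f) : ℂ) • expAbs (Iio 0) hs := by
    rw [barrierResolvent_apply]
    change _ + (rankOneCoeff κ s : ℂ) • (inner ℂ (oddExp hs) f • -expAbs (Iio 0) hs) = _
    rw [neg_smul, smul_neg, smul_neg, smul_smul]
    rfl
  rw [e]
  filter_upwards [Lp.coeFn_add (restrictTo (Iio 0) (lineResolvent hs (glue f)))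
      ((-(rankOneCoeff κ s * inner ℂ (oddExp hs) f) : ℂ) • expAbs (Iio 0) hs),
    Lp.coeFn_smul (-(rankOneCoeff κ s * inner ℂ (oddExp hs) f) : ℂ) (expAbs (Iio 0) hs),
    restrictTo_coeFn (Iio 0) (lineResolvent hs (glue f)),
    ae_restrict_of_ae (lineResolvent_coeFn hs (glue f)), expAbs_coeFn (Iio 0) hs] with x h1 h2 h3 h4 h5
  rw [h1, Pi.add_apply, h2, Pi.smul_apply, h3, h4, h5, greenFun_glue hs,
    integral_barrierKernel κ hs, integral_barrierKernel κ hs, inner_oddExp, smul_eq_mul]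
  push_cast
  ring

lemma barrierResolvent_snd_ae (κ : ℝ) {s : ℝ} (hs : 0 < s) (f : TwoSided) :
    ∀ᵐ x ∂(volume.restrict (Ioi (0 : ℝ))), (barrierResolvent κ hs f).snd x =
      (∫ y in Iio (0 : ℝ), (barrierKernel κ s (-1) x y : ℂ) * f.fst y) +
        ∫ y in Ioi (0 : ℝ), (barrierKernel κ s 1 x y : ℂ) * f.snd y := by
  have e : (barrierResolvent κ hs f).snd = restrictTo (Ioi 0) (lineResolvent hs (glue f)) +
      (rankOneCoeff κ s * inner ℂ (oddExp hs) f : ℂ) • expAbs (Ioi 0) hs := by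
    rw [barrierResolvent_apply]
    change _ + (rankOneCoeff κ s : ℂ) • (inner ℂ (oddExp hs) f • expAbs (Ioi 0) hs) = _
    rw [smul_smul]
    rfl
  rw [e]
  filter_upwards [Lp.coeFn_add (restrictTo (Ioi 0) (lineResolvent hs (glue f)))
      ((rankOneCoeff κ s * inner ℂ (oddExp hs) f : ℂ) • expAbs (Ioi 0) hs),
    Lp.coeFn_smul (rankOneCoeff κ s * inner ℂ (oddExp hs) f : ℂ) (expAbs (Ioi 0) hs),
    restrictTo_coeFn (Ioi 0) (lineResolvent hs (glue f)),
    ae_restrict_of_ae (lineResolvent_coeFn hs (glue f)), expAbs_coeFn (Ioi 0) hs] with x h1 h2 h3 h4 h5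
  rw [h1, Pi.add_apply, h2, Pi.smul_apply, h3, h4, h5, greenFun_glue hs,
    integral_barrierKernel κ hs, integral_barrierKernel κ hs, inner_oddExp, smul_eq_mul]
  push_cast
  ring

/-! ### The spectrum of the barrier operator -/

lemma nonnegHalfLine_subset_essentialSpectrum (κ : ℝ) :
    nonnegHalfLine ⊆ essentialSpectrum (barrierLaplacian κ) := by
  rintro _ ⟨r, hr, rfl⟩
  have := sq_mem_essentialSpectrum κ √r
  rwa [Real.sq_sqrt hr] at this

lemma nonnegHalfLine_subset_opSpectrum (κ : ℝ) :
    nonnegHalfLine ⊆ opSpectrum (barrierLaplacian κ) :=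
  (nonnegHalfLine_subset_essentialSpectrum κ).trans (essentialSpectrum_subset_opSpectrum _)

lemma exists_pos_add_ne_zero (κ : ℝ) : ∃ s : ℝ, 0 < s ∧ s + 2 * κ ≠ 0 :=
  ⟨1 + 2 * |κ|, by positivity, ne_of_gt (by linarith [neg_abs_le κ])⟩

lemma isSelfAdjoint_barrierLaplacian (κ : ℝ) : IsSelfAdjoint (barrierLaplacian κ) := by
  obtain ⟨s, hs, h⟩ := exists_pos_add_ne_zero κ
  exact isSelfAdjoint_of_resolvent (isResolventAt_barrierResolvent hs h)
    (inner_barrierResolvent κ hs)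

/-- Nonreal points are removed by self-adjointness of a resolvent. A negative point `r` has an
explicit resolvent with `s = √(-r)`, unless `s = -2 κ`, which forces `κ < 0` and `r = -4 κ²`. -/
lemma mem_opSpectrum_cases {κ : ℝ} {z : ℂ} (hz : z ∈ opSpectrum (barrierLaplacian κ)) :
    z ∈ nonnegHalfLine ∨ (κ < 0 ∧ z = ((-4 * κ ^ 2 : ℝ) : ℂ)) := by
  by_cases him : z.im = 0
  · obtain ⟨r, rfl⟩ : ∃ r : ℝ, z = r := ⟨z.re, Complex.ext (by simp) (by simp [him])⟩
    rcases le_or_gt 0 r with hr | hr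
    · exact Or.inl ⟨r, hr, rfl⟩
    have hs : 0 < √(-r) := Real.sqrt_pos.mpr (neg_pos.mpr hr)
    have hr2 : r = -√(-r) ^ 2 := by rw [Real.sq_sqrt (by linarith), neg_neg]
    by_cases h : √(-r) + 2 * κ = 0
    · have hκ : √(-r) = -2 * κ := by linarith
      refine Or.inr ⟨by linarith, ?_⟩
      rw [hr2, hκ]
      congr 1
      ring
    · have hR := isResolventAt_barrierResolvent hs h
      rw [← hr2] at hR
      exact absurd ⟨_, hR⟩ hz
  · obtain ⟨s, hs, h⟩ := exists_pos_add_ne_zero κ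
    exact absurd (exists_isResolventAt_of_im_ne_zero (isResolventAt_barrierResolvent hs h)
      (inner_barrierResolvent κ hs) him) hz

lemma neg_four_mul_sq (κ : ℝ) : -4 * κ ^ 2 = -(-2 * κ) ^ 2 := by ring

/-- The comparison operator is the one with `κ = 0`, which has no negative spectrum; its resolvents
exist both at the auxiliary point and at `-4 κ²`. -/
lemma notMem_essentialSpectrum {κ : ℝ} (hκ : κ < 0) :
    ((-4 * κ ^ 2 : ℝ) : ℂ) ∉ essentialSpectrum (barrierLaplacian κ) := by
  -- The auxiliary point is `-s²` with `s = 1 - 2 κ`, for which `s + 2 κ = 1`, so the resolvent for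
  -- `κ` exists there.
  have hs : 0 < 1 - 2 * κ := by linarith
  have hs' : 0 < -2 * κ := by linarith
  rw [neg_four_mul_sq]
  refine notMem_essentialSpectrum_of_rank_one
    (isResolventAt_barrierResolvent (κ := κ) hs 
      (by rw [sub_add_cancel]; exact one_ne_zero))
    (isResolventAt_barrierResolvent (κ := 0) hs (by rw [mul_zero, add_zero]; exact hs.ne'))
    (isResolventAt_barrierResolvent (κ := 0) hs' (by rw [mul_zero, add_zero]; exact hs'.ne'))
    (c := rankOneCoeff κ (1 - 2 * κ) - rankOneCoeff 0 (1 - 2 * κ)) (L := oddExp hs) fun f => ?_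
  rw [barrierResolvent_apply, barrierResolvent_apply]
  module

lemma essentialSpectrum_barrierLaplacian (κ : ℝ) :
    essentialSpectrum (barrierLaplacian κ) = nonnegHalfLine := by
  refine Subset.antisymm (fun z hz => ?_) (nonnegHalfLine_subset_essentialSpectrum κ)
  rcases mem_opSpectrum_cases (essentialSpectrum_subset_opSpectrum _ hz) with h | ⟨hκ, rfl⟩
  · exact h
  · exact absurd hz (notMem_essentialSpectrum hκ)

/-- No point of `[0, ∞)` is isolated, since the whole half-line lies in the spectrum. -/
lemma notMem_discreteSpectrum_of_nonneg {κ : ℝ} {z : ℂ} (hz : z ∈ nonnegHalfLine) :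
    z ∉ discreteSpectrum (barrierLaplacian κ) := by
  rintro ⟨-, ⟨ε, hε, h⟩, -⟩
  obtain ⟨r, hr, rfl⟩ := hz
  have hr' : (0 : ℝ) ≤ r := hr
  have e := h ((r + ε / 2 : ℝ) : ℂ) (nonnegHalfLine_subset_opSpectrum κ
    ⟨r + ε / 2, by simp only [mem_Ici]; linarith, rfl⟩) (by
      rw [Complex.dist_eq, ← Complex.ofReal_sub, Complex.norm_real, Real.norm_eq_abs,
        add_sub_cancel_left, abs_of_pos (by linarith)]
      linarith)
  have : r + ε / 2 = r := Complex.ofReal_injective e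
  linarith

lemma eigenspace_barrierLaplacian {κ : ℝ} (hs : 0 < -2 * κ) :
    eigenspace (barrierLaplacian κ) ((-4 * κ ^ 2 : ℝ) : ℂ) = ℂ ∙ oddExp hs := by
  have hmem : oddExp hs ∈ eigenspace (barrierLaplacian κ) ((-4 * κ ^ 2 : ℝ) : ℂ) := by
    rw [mem_eigenspace_iff, barrierLaplacian_graph, neg_four_mul_sq]
    exact oddExp_mem_barrierGraph hs (by ring)
  refine le_antisymm (fun u hu => ?_) ((Submodule.span_singleton_le_iff_mem _ _).mpr hmem)
  rw [mem_eigenspace_iff, barrierLaplacian_graph, neg_four_mul_sq] at hu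
  obtain ⟨b, hb, -⟩ := exists_smul_oddExp_of_mem_barrierGraph hs hu
  exact Submodule.mem_span_singleton.mpr ⟨b, hb.symm⟩

lemma isEigenvalue_barrierLaplacian {κ : ℝ} (hκ : κ < 0) :
    IsEigenvalue (barrierLaplacian κ) ((-4 * κ ^ 2 : ℝ) : ℂ) := by
  have hs : 0 < -2 * κ := by linarith
  refine ⟨oddExp hs, ?_, oddExp_ne_zero hs⟩
  rw [eigenspace_barrierLaplacian hs]
  exact Submodule.mem_span_singleton_self _

lemma opSpectrum_barrierLaplacian_of_neg {κ : ℝ} (hκ : κ < 0) :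
    opSpectrum (barrierLaplacian κ) = {((-4 * κ ^ 2 : ℝ) : ℂ)} ∪ nonnegHalfLine := by
  refine Subset.antisymm (fun z hz => ?_) (union_subset ?_ (nonnegHalfLine_subset_opSpectrum κ))
  · rcases mem_opSpectrum_cases hz with h | ⟨-, h⟩
    · exact Or.inr h
    · exact Or.inl h
  · rintro _ rfl
    exact (isEigenvalue_barrierLaplacian hκ).mem_opSpectrum

lemma discreteSpectrum_barrierLaplacian_of_neg {κ : ℝ} (hκ : κ < 0) :
    discreteSpectrum (barrierLaplacian κ) = {((-4 * κ ^ 2 : ℝ) : ℂ)} := by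
  have hs : 0 < -2 * κ := by linarith
  refine Subset.antisymm (fun z hz => ?_) ?_
  · rcases mem_opSpectrum_cases hz.1 with h | ⟨-, h⟩
    · exact absurd hz (notMem_discreteSpectrum_of_nonneg h)
    · exact h
  · rintro _ rfl
    -- The isolation radius `4 κ²` is the distance from the eigenvalue to the half-line.
    refine ⟨(isEigenvalue_barrierLaplacian hκ).mem_opSpectrum,
      ⟨4 * κ ^ 2, by nlinarith, fun w hw hd => ?_⟩, isEigenvalue_barrierLaplacian hκ, ?_⟩
    · rcases mem_opSpectrum_cases hw with ⟨r, hr, rfl⟩ | ⟨-, h⟩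
      · have hr' : (0 : ℝ) ≤ r := hr
        rw [Complex.dist_eq, ← Complex.ofReal_sub, Complex.norm_real, Real.norm_eq_abs] at hd
        have := (abs_lt.mp hd).2
        linarith
      · exact h
    · rw [eigenspace_barrierLaplacian hs]
      infer_instance

lemma isEigenvalue_barrierLaplacian_iff {κ μ : ℝ} (hκ : κ < 0) (hμ : μ < 0) :
    IsEigenvalue (barrierLaplacian κ) (μ : ℂ) ↔ μ = -4 * κ ^ 2 := by
  refine ⟨fun h => ?_, fun h => h ▸ isEigenvalue_barrierLaplacian hκ⟩
  rcases mem_opSpectrum_cases h.mem_opSpectrum with ⟨r, hr, e⟩ | ⟨-, h⟩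
  · have hr' : (0 : ℝ) ≤ r := hr
    have : r = μ := Complex.ofReal_injective e
    linarith
  · exact_mod_cast h

lemma finrank_eigenspace_barrierLaplacian {κ : ℝ} (hκ : κ < 0) :
    Module.finrank ℂ (eigenspace (barrierLaplacian κ) ((-4 * κ ^ 2 : ℝ) : ℂ)) = 1 := by
  have hs : 0 < -2 * κ := by linarith
  rw [eigenspace_barrierLaplacian hs]
  exact finrank_span_singleton (oddExp_ne_zero hs)

lemma opSpectrum_barrierLaplacian_of_nonneg {κ : ℝ} (hκ : 0 ≤ κ) :
    opSpectrum (barrierLaplacian κ) = nonnegHalfLine :=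
  Subset.antisymm (fun _ hz => (mem_opSpectrum_cases hz).resolve_right fun h => h.1.not_ge hκ)
    (nonnegHalfLine_subset_opSpectrum κ)

lemma discreteSpectrum_barrierLaplacian_of_nonneg {κ : ℝ} (hκ : 0 ≤ κ) :
    discreteSpectrum (barrierLaplacian κ) = ∅ := by
  refine eq_empty_of_forall_notMem fun z hz => ?_
  have h := hz.1
  rw [opSpectrum_barrierLaplacian_of_nonneg hκ] at h
  exact notMem_discreteSpectrum_of_nonneg h hz

/-- The coefficient of the resolvent formula is singular only if `√(-μ) = -2 κ`, and then `μ` is the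
eigenvalue `-4 κ²`. -/
lemma sqrt_add_ne_zero_of_notMem_opSpectrum {κ μ : ℝ} (hμ : μ < 0)
    (h : (μ : ℂ) ∉ opSpectrum (barrierLaplacian κ)) : √(-μ) + 2 * κ ≠ 0 := by
  intro h0
  have hs : 0 < √(-μ) := Real.sqrt_pos.mpr (neg_pos.mpr hμ)
  have hκ : κ < 0 := by linarith
  refine h ?_
  have hμ' : μ = -4 * κ ^ 2 := by
    rw [neg_four_mul_sq, ← show √(-μ) = -2 * κ by linarith, Real.sq_sqrt (by linarith), neg_neg]
  rw [hμ']
  exact (isEigenvalue_barrierLaplacian hκ).mem_opSpectrum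

end SemiPermeable

end

theorem mainTheorem10 (κ : ℝ) :
    -- `T₀` is self-adjoint (in particular densely defined)
    IsSelfAdjoint (SemiPermeable.barrierLaplacian κ) ∧
    -- essential spectrum, for every real `κ`
    SemiPermeable.essentialSpectrum (SemiPermeable.barrierLaplacian κ)
      = SemiPermeable.nonnegHalfLine ∧
    -- the case `κ ≥ 0`
    (0 ≤ κ →
      SemiPermeable.discreteSpectrum (SemiPermeable.barrierLaplacian κ) = ∅ ∧
      SemiPermeable.opSpectrum (SemiPermeable.barrierLaplacian κ)
        = SemiPermeable.nonnegHalfLine) ∧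
    -- the case `κ < 0`
    (κ < 0 →
      (∀ μ : ℝ, μ < 0 →
        (SemiPermeable.IsEigenvalue (SemiPermeable.barrierLaplacian κ) (μ : ℂ)
          ↔ μ = -4 * κ ^ 2)) ∧
      Module.finrank ℂ (SemiPermeable.eigenspace (SemiPermeable.barrierLaplacian κ)
        ((-4 * κ ^ 2 : ℝ) : ℂ)) = 1 ∧
      SemiPermeable.discreteSpectrum (SemiPermeable.barrierLaplacian κ)
        = {((-4 * κ ^ 2 : ℝ) : ℂ)} ∧
      SemiPermeable.opSpectrum (SemiPermeable.barrierLaplacian κ)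
        = {((-4 * κ ^ 2 : ℝ) : ℂ)} ∪ SemiPermeable.nonnegHalfLine) ∧
    -- the resolvent at `μ < 0`, `μ ∉ σ(T₀)`
    (∀ (μ : ℝ) (hμ : μ < 0),
      ((μ : ℂ) ∉ SemiPermeable.opSpectrum (SemiPermeable.barrierLaplacian κ)) →
      ∃ (R : SemiPermeable.TwoSided →L[ℂ] SemiPermeable.TwoSided)
        (RΔ : SemiPermeable.L2Line →L[ℂ] SemiPermeable.L2Line),
        SemiPermeable.IsResolventAt (SemiPermeable.barrierLaplacian κ) (μ : ℂ) R ∧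
        SemiPermeable.IsResolventAt SemiPermeable.lineLaplacian (μ : ℂ) RΔ ∧
        -- rank-one perturbation formula
        (∀ f : SemiPermeable.TwoSided,
          R f = SemiPermeable.split (RΔ (SemiPermeable.glue f))
            + ((1 / (2 * (√(-μ) + 2 * κ)) : ℝ) : ℂ)
              • SemiPermeable.barrierPerturbation (Real.sqrt_pos.mpr (neg_pos.mpr hμ)) f) ∧
        -- integral kernel
        (∀ f : SemiPermeable.TwoSided,
          (∀ᵐ x ∂(MeasureTheory.volume.restrict (Set.Iio (0 : ℝ))),
            (R f).fst x
              = (∫ y in Set.Iio (0 : ℝ),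
                  (SemiPermeable.barrierKernel κ (√(-μ)) 1 x y : ℂ) * f.fst y)
                + ∫ y in Set.Ioi (0 : ℝ),
                  (SemiPermeable.barrierKernel κ (√(-μ)) (-1) x y : ℂ) * f.snd y) ∧
          (∀ᵐ x ∂(MeasureTheory.volume.restrict (Set.Ioi (0 : ℝ))),
            (R f).snd x
              = (∫ y in Set.Iio (0 : ℝ),
                  (SemiPermeable.barrierKernel κ (√(-μ)) (-1) x y : ℂ) * f.fst y)
                + ∫ y in Set.Ioi (0 : ℝ),
                  (SemiPermeable.barrierKernel κ (√(-μ)) 1 x y : ℂ) * f.snd y))) := by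
  refine ⟨SemiPermeable.isSelfAdjoint_barrierLaplacian κ,
    SemiPermeable.essentialSpectrum_barrierLaplacian κ,
    fun hκ => ⟨SemiPermeable.discreteSpectrum_barrierLaplacian_of_nonneg hκ,
      SemiPermeable.opSpectrum_barrierLaplacian_of_nonneg hκ⟩,
    fun hκ => ⟨fun μ hμ => SemiPermeable.isEigenvalue_barrierLaplacian_iff hκ hμ,
      SemiPermeable.finrank_eigenspace_barrierLaplacian hκ,
      SemiPermeable.discreteSpectrum_barrierLaplacian_of_neg hκ,
      SemiPermeable.opSpectrum_barrierLaplacian_of_neg hκ⟩,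
    fun μ hμ hσ => ?_⟩
  have hs : 0 < √(-μ) := Real.sqrt_pos.mpr (neg_pos.mpr hμ)
  have hμ2 : -√(-μ) ^ 2 = μ := by rw [Real.sq_sqrt (by linarith), neg_neg]
  refine ⟨SemiPermeable.barrierResolvent κ hs, SemiPermeable.lineResolvent hs, ?_, ?_,
    fun f => ?_, fun f => ⟨SemiPermeable.barrierResolvent_fst_ae κ hs f,
      SemiPermeable.barrierResolvent_snd_ae κ hs f⟩⟩
  · have := SemiPermeable.isResolventAt_barrierResolvent hs
      (SemiPermeable.sqrt_add_ne_zero_of_notMem_opSpectrum hμ hσ)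
    rwa [hμ2] at this
  · have := SemiPermeable.isResolventAt_lineResolvent hs
    rwa [hμ2] at this
  · rw [SemiPermeable.barrierPerturbation_eq]
    exact SemiPermeable.barrierResolvent_apply κ hs f
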